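/- **Setting.** Let $\mathbf A=(a_{ij})_{i,j\in\mathbf I}$ be an indecomposable symmetrizable generalized Cartan matrix ($\mathbf I$ finite and nonempty), $d_i$ $(i\in\mathbf I)$ the positive relatively prime integers with $d_ia_{ij}=d_ja_{ji}$, and $d_{ij}=\tfrac12 d_ia_{ij}$, so that $d_{ii}=d_i$. Let $(\mathfrak h,\{\alpha_i\},\{\alpha_i^\vee\})$ be a realization of $\mathbf A$ over $\mathbb C$: $\{\alpha_i\}\subset\mathfrak h^*$ and $\{\alpha_i^\vee\}\subset\mathfrak h$ are linearly independent, $\alpha_j(\alpha_i^\vee)=a_{ij}$, and $\dim\mathfrak h=2|\mathbf I|-\operatorname{rank}\mathbf A$. Let $\mathfrak g$ be the associated Kac–Moody algebra, generated by $\mathfrak h$ and Chevalley generators $e_i,f_i$ with $[\mathfrak h,\mathfrak h]=0$, $[h,e_i]=\alpha_i(h)e_i$, $[h,f_i]=-\alpha_i(h)f_i$, $[e_i,f_j]=\delta_{ij}\alpha_i^\vee$ and the Serre relations. Put $x_i^+=\sqrt{d_i}\,e_i$, $x_i^-=\sqrt{d_i}\,f_i$, $h_i=d_i\alpha_i^\vee$.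 **The Yangian.** $Y_\hbar\mathfrak g$ is the unital associative $\mathbb C[\hbar]$-algebra generated by $\mathfrak h$ (linearly) and $x_{ir}^\pm,h_{ir}$ ($i\in\mathbf I$, $r\in\mathbb N$), subject to the relations, for all $i,j\in\mathbf I$, all indices $r,s$ and $h,h'\in\mathfrak h$, $$h_{i0}=d_i\alpha_i^\vee,\quad [h_{ir},h_{js}]=[h_{ir},h]=[h,h']=0,\quad [h,x_{js}^\pm]=\pm\alpha_j(h)x_{js}^\pm,\quad [x_{ir}^+,x_{js}^-]=\delta_{ij}h_{i,r+s},$$ $$[h_{i,r+1},x_{js}^\pm]-[h_{ir},x_{j,s+1}^\pm]=\pm\hbar d_{ij}(h_{ir}x_{js}^\pm+x_{js}^\pm h_{ir}),$$ $$[x_{i,r+1}^\pm,x_{js}^\pm]-[x_{ir}^\pm,x_{j,s+1}^\pm]=\pm\hbar d_{ij}(x_{ir}^\pm x_{js}^\pm+x_{js}^\pm x_{ir}^\pm),$$ $$\sum_{\pi\in S_m}\bigl[x_{i,r_{\pi(1)}}^\pm,\bigl[x_{i,r_{\pi(2)}}^\pm,\cdots,[x_{i,r_{\pi(m)}}^\pm,x_{js}^\pm]\cdots\bigr]\bigr]=0\qquad(i\ne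 j,\ m=1-a_{ij},\ \text{all } r_1,\dots,r_m,s).$$ It is $\mathbb N$-graded, $Y_\hbar\mathfrak g=\bigoplus_{k}Y_k$, with $\deg\hbar=1$, $\deg\mathfrak h=0$, $\deg x_{ir}^\pm=\deg h_{ir}=r$. Let $\widehat{Y_\hbar\mathfrak g}=\prod_{k\in\mathbb N}Y_k$ be its completion, a $\mathbb C[[\hbar]]$-algebra, and $\widehat Y_{\ge n}=\prod_{k\ge n}Y_k$. For $c\in\mathbb C$, the shift homomorphism $\tau_c$ of $Y_\hbar\mathfrak g$ is given by $\tau_c(h)=h$, $\tau_c(x_{ir}^\pm)=\sum_{k=0}^r\binom rk c^{r-k}x_{ik}^\pm$, $\tau_c(h_{ir})=\sum_{k=0}^r\binom rk c^{r-k}h_{ik}$. **The Yangian double.** $\mathrm DY_\hbar\mathfrak g$ is the unital associative $\mathbb C[[\hbar]]$-algebra topologically generated by $\mathfrak h$ and $\mathcal X_{ir}^\pm,\mathcal H_{ir}$ ($i\in\mathbf I$, $r\in\mathbb Z$) subject to the same relations, with all indices now in $\mathbb Z$; it is separated and complete for the $\hbar$-adic topology. Let $\iota:Y_\hbar\mathfrak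 g\to\mathrm DY_\hbar\mathfrak g$ be the natural homomorphism $h\mapsto h$, $x_{ir}^\pm\mapsto\mathcal X_{ir}^\pm$, $h_{ir}\mapsto\mathcal H_{ir}$. The evaluation ideal $\mathcal J$ (at $t=1$) is the kernel of the ring homomorphism $\mathrm DY_\hbar\mathfrak g\to U(\mathfrak g)$, $\hbar\mapsto0$, $h\mapsto h$, $\mathcal X_{ir}^\pm\mapsto x_i^\pm$, $\mathcal H_{ir}\mapsto h_i$ for all $r\in\mathbb Z$. Let $\widehat{\mathrm DY_\hbar\mathfrak g}=\varprojlim_n\mathrm DY_\hbar\mathfrak g/\mathcal J^n$. **The maps.** There is a unique $\mathbb C[[\hbar]]$-algebra homomorphism $\Phi=\Phi_1:\mathrm DY_\hbar\mathfrak g\to\widehat{Y_\hbar\mathfrak g}$ with $\Phi\circ\iota=\tau_1$ (the right side viewed in $\widehat{Y_\hbar\mathfrak g}$), and it satisfies $$\Phi(\mathcal X_{ir}^\pm)=\sum_{n\ge0}\binom rn x_{in}^\pm,\qquad \Phi(\mathcal H_{ir})=\sum_{n\ge0}\binom rn h_{in}\qquad(i\in\mathbf I,\ r\in\mathbb Z).$$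 Let $\Gamma=\iota\circ\tau_{-1}:Y_\hbar\mathfrak g\to\mathrm DY_\hbar\mathfrak g$. **Theorem.** For every $n\in\mathbb N$ one has $\Phi(\mathcal J^n)\subset\widehat Y_{\ge n}$ and $\Gamma\bigl(\bigoplus_{k\ge n}Y_k\bigr)\subset\mathcal J^n$. The inverse limits $$\widehat\Phi:\widehat{\mathrm DY_\hbar\mathfrak g}\to\widehat{Y_\hbar\mathfrak g},\qquad \widehat\Gamma:\widehat{Y_\hbar\mathfrak g}\to\widehat{\mathrm DY_\hbar\mathfrak g}$$ of the homomorphisms $\mathrm DY_\hbar\mathfrak g/\mathcal J^n\to\widehat{Y_\hbar\mathfrak g}/\widehat Y_{\ge n}$ and $Y_\hbar\mathfrak g/\bigoplus_{k\ge n}Y_k\to\mathrm DY_\hbar\mathfrak g/\mathcal J^n$ induced by $\Phi$ and $\Gamma$ are homomorphisms of $\mathbb C[[\hbar]]$-algebras and are mutually inverse: $\widehat\Phi\circ\widehat\Gamma=\mathrm{id}$ and $\widehat\Gamma\circ\widehat\Phi=\mathrm{id}$. In particular, $\widehat\Phi$ is an isomorphism of $\mathbb C[[\hbar]]$-algebras.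 -/

import Mathlib

open scoped PowerSeries Polynomial

set_option linter.unusedSectionVars false

namespace YangianDouble

/-- The data fixed throughout: an indecomposable symmetrizable generalized Cartan matrix `A`
with index set `I`, its positive relatively prime integers `d i` with `d i * A i j = d j * A j i`,
and a realization of `A` (in the sense of Kac) on the complex vector space `H`. -/
structure CartanRealization (I H : Type*) [Fintype I] [AddCommGroup H] [Module ℂ H] where
  /-- the generalized Cartan matrix -/
  A : Matrix I I ℤ
  diag : ∀ i, A i i = 2
  offDiag : ∀ i j, i ≠ j → A i j ≤ 0
  zero_symm : ∀ i j, A i j = 0 → A j i = 0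
  indecomposable : ∀ S : Set I, S.Nonempty → S ≠ Set.univ → ∃ i ∈ S, ∃ j ∉ S, A i j ≠ 0
  /-- the symmetrizing integers, `d i = (α_i, α_i) / 2` for the normalized invariant form -/
  d : I → ℕ
  d_pos : ∀ i, 0 < d i
  d_coprime : Finset.univ.gcd d = 1
  symmetrizes : ∀ i j, (d i : ℤ) * A i j = (d j : ℤ) * A j i
  /-- the simple coroots -/
  coroot : I → H
  /-- the simple roots -/
  root : I → Module.Dual ℂ H
  coroot_indep : LinearIndependent ℂ coroot
  root_indep : LinearIndependent ℂ root
  pairing : ∀ i j, root j (coroot i) = (A i j : ℂ)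
  /-- `dim H = 2 |I| - rank A`; as `I` is nonempty, this forces `H` to be finite-dimensional -/
  finrank_eq : Module.finrank ℂ H + (A.map (Int.cast : ℤ → ℂ)).rank = 2 * Fintype.card I

/-- Symbols for the generators: `cart a` for `a ∈ 𝔥`, `x e i r` for `x_{i,r}^±` with the sign
`e = ±1 : ℤˣ`, and `h i r` for `h_{i,r}`. The modes `r` run over `K`, which is `ℕ` for the Yangian
and `ℤ` for the Yangian double. -/
inductive Gen (I H K : Type*)
  | cart : H → Gen I H K
  | x : ℤˣ → I → K → Gen I H K
  | h : I → K → Gen I H K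

section Presentation

variable {I H : Type*} [Fintype I] [DecidableEq I] [AddCommGroup H] [Module ℂ H]

/-- `d_{ij} = (α_i, α_j) / 2`, where `(α_i, α_j) = d_i a_{ij}` for the normalized invariant form. -/
noncomputable def CartanRealization.dd (D : CartanRealization I H) (i j : I) : ℂ :=
  (D.d i : ℂ) * (D.A i j : ℂ) / 2

/-- The iterated commutator `[y₁, [y₂, ⋯ [yₘ, z] ⋯ ]]`. -/
def nest {B : Type*} [Ring B] {m : ℕ} (y : Fin m → B) (z : B) : B :=
  (List.ofFn y).foldr (fun a b => ⁅a, b⁆) z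

/-- The defining relations of the Yangian (modes in `ℕ`) and of the Yangian double (modes in `ℤ`),
written as `relator = 0`, for a family `g` of elements of an `R`-algebra `B` indexed by the generator
symbols, with deformation parameter `hbar ∈ R`. For modes in `ℤ` these are the coefficients of the
relations between the generating series `∑_{r ∈ ℤ} X_{i,r} u^{-r-1}`. The brackets are commutators;
`cart_add` and `cart_smul` say that the symbols `cart a` depend linearly on `a ∈ 𝔥`. -/
inductive Relator (D : CartanRealization I H) {R : Type*} [CommRing R] [Algebra ℂ R] (hbar : R)
    {K : Type*} [AddMonoidWithOne K] {B : Type*} [Ring B] [Algebra R B] (g : Gen I H K → B) :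
    B → Prop
  | cart_add (a b : H) : Relator D hbar g (g (.cart (a + b)) - (g (.cart a) + g (.cart b)))
  | cart_smul (c : ℂ) (a : H) :
      Relator D hbar g (g (.cart (c • a)) - algebraMap ℂ R c • g (.cart a))
  | h_zero (i : I) : Relator D hbar g (g (.h i 0) - g (.cart ((D.d i : ℂ) • D.coroot i)))
  | h_h (i j : I) (r s : K) : Relator D hbar g ⁅g (.h i r), g (.h j s)⁆
  | h_cart (i : I) (r : K) (a : H) : Relator D hbar g ⁅g (.h i r), g (.cart a)⁆
  | cart_cart (a b : H) : Relator D hbar g ⁅g (.cart a), g (.cart b)⁆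
  | cart_x (a : H) (e : ℤˣ) (j : I) (s : K) :
      Relator D hbar g (⁅g (.cart a), g (.x e j s)⁆ -
        algebraMap ℂ R (((e : ℤ) : ℂ) * D.root j a) • g (.x e j s))
  | x_x_neg (i j : I) (r s : K) :
      Relator D hbar g (⁅g (.x 1 i r), g (.x (-1) j s)⁆ - if i = j then g (.h i (r + s)) else 0)
  | h_x (e : ℤˣ) (i j : I) (r s : K) :
      Relator D hbar g (⁅g (.h i (r + 1)), g (.x e j s)⁆ - ⁅g (.h i r), g (.x e j (s + 1))⁆ -
        (algebraMap ℂ R (((e : ℤ) : ℂ) * D.dd i j) * hbar) •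
          (g (.h i r) * g (.x e j s) + g (.x e j s) * g (.h i r)))
  | x_x (e : ℤˣ) (i j : I) (r s : K) :
      Relator D hbar g (⁅g (.x e i (r + 1)), g (.x e j s)⁆ - ⁅g (.x e i r), g (.x e j (s + 1))⁆ -
        (algebraMap ℂ R (((e : ℤ) : ℂ) * D.dd i j) * hbar) •
          (g (.x e i r) * g (.x e j s) + g (.x e j s) * g (.x e i r)))
  | serre (e : ℤˣ) (i j : I) (hij : i ≠ j) (r : Fin (1 - D.A i j).toNat → K) (s : K) :
      Relator D hbar g (∑ p : Equiv.Perm (Fin (1 - D.A i j).toNat),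
        nest (fun k => g (.x e i (r (p k)))) (g (.x e j s)))

/-- The unital associative `R`-algebra with generators `Gen I H K` and the above relations. -/
def Presented (D : CartanRealization I H) {R : Type*} [CommRing R] [Algebra ℂ R] (hbar : R)
    (K : Type*) [AddMonoidWithOne K] : Type _ :=
  RingQuot fun a b : FreeAlgebra R (Gen I H K) =>
    Relator D hbar (FreeAlgebra.ι R) a ∧ b = 0

variable (D : CartanRealization I H) {R : Type*} [CommRing R] [Algebra ℂ R] (hbar : R)
    (K : Type*) [AddMonoidWithOne K]

noncomputable instance : Ring (Presented D hbar K) :=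
  inferInstanceAs (Ring (RingQuot _))

noncomputable instance {S : Type*} [CommSemiring S] [Algebra S R] :
    Algebra S (Presented D hbar K) :=
  inferInstanceAs (Algebra S (RingQuot _))

instance {S T : Type*} [CommSemiring S] [CommSemiring T] [Algebra S R] [Algebra T R] [SMul S T]
    [IsScalarTower S T R] : IsScalarTower S T (Presented D hbar K) :=
  inferInstanceAs (IsScalarTower S T (RingQuot _))

/-- The generators of the presented algebra. -/
noncomputable def Presented.gen (y : Gen I H K) : Presented D hbar K :=
  RingQuot.mkAlgHom R _ (FreeAlgebra.ι R y)

variable {D hbar K}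

theorem map_lie_ring {B C : Type*} [Ring B] [Ring C] (f : B →+* C) (a b : B) :
    f ⁅a, b⁆ = ⁅f a, f b⁆ := by
  simp [Ring.lie_def]

theorem map_nest {B C : Type*} [Ring B] [Ring C] (f : B →+* C) {m : ℕ} (y : Fin m → B) (z : B) :
    f (nest y z) = nest (fun k => f (y k)) (f z) := by
  have key : ∀ l : List B, f (l.foldr (fun a b => ⁅a, b⁆) z) =
      (l.map f).foldr (fun a b => ⁅a, b⁆) (f z) := by
    intro l
    induction l with
    | nil => rfl
    | cons a l ih => rw [List.foldr_cons, map_lie_ring, ih]; rfl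
  rw [nest, nest, key, List.map_ofFn]; rfl

theorem relator_map_iff {B C : Type*} [Ring B] [Algebra R B] [Ring C] [Algebra R C]
    (f : B →ₐ[R] C) {g : Gen I H K → B} {c : C} :
    Relator D hbar (fun y => f (g y)) c ↔ ∃ b, Relator D hbar g b ∧ f b = c := by
  have hl : ∀ a b : B, f ⁅a, b⁆ = ⁅f a, f b⁆ := map_lie_ring (f : B →+* C)
  have hn : ∀ {m : ℕ} (y : Fin m → B) (z : B), f (nest y z) = nest (fun k => f (y k)) (f z) :=
    fun y z => map_nest (f : B →+* C) y z
  constructor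
  · intro hc
    cases hc with
    | cart_add a b => exact ⟨_, .cart_add a b, by simp⟩
    | cart_smul c a => exact ⟨_, .cart_smul c a, by simp⟩
    | h_zero i => exact ⟨_, .h_zero i, by simp⟩
    | h_h i j r s => exact ⟨_, .h_h i j r s, hl _ _⟩
    | h_cart i r a => exact ⟨_, .h_cart i r a, hl _ _⟩
    | cart_cart a b => exact ⟨_, .cart_cart a b, hl _ _⟩
    | cart_x a e j s => exact ⟨_, .cart_x a e j s, by rw [map_sub, map_smul, hl]⟩
    | x_x_neg i j r s =>
      exact ⟨_, .x_x_neg i j r s, by rw [map_sub, hl, apply_ite f, map_zero]⟩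
    | h_x e i j r s =>
      exact ⟨_, .h_x e i j r s, by
        rw [map_sub, map_sub, map_smul, hl, hl, map_add, map_mul f, map_mul f]⟩
    | x_x e i j r s =>
      exact ⟨_, .x_x e i j r s, by
        rw [map_sub, map_sub, map_smul, hl, hl, map_add, map_mul f, map_mul f]⟩
    | serre e i j hij r s => exact ⟨_, .serre e i j hij r s, by simp only [map_sum, hn]⟩
  · rintro ⟨b, hb, rfl⟩
    cases hb with
    | cart_add a b => simpa using Relator.cart_add (D := D) (hbar := hbar) (g := fun y => f (g y)) a b
    | cart_smul c a => simpa using Relator.cart_smul (D := D) (hbar := hbar) (g := fun y => f (g y)) c a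
    | h_zero i => simpa using Relator.h_zero (D := D) (hbar := hbar) (g := fun y => f (g y)) i
    | h_h i j r s => rw [hl]; exact .h_h i j r s
    | h_cart i r a => rw [hl]; exact .h_cart i r a
    | cart_cart a b => rw [hl]; exact .cart_cart a b
    | cart_x a e j s => rw [map_sub, map_smul, hl]; exact .cart_x a e j s
    | x_x_neg i j r s =>
      rw [map_sub, hl, apply_ite f, map_zero]; exact .x_x_neg i j r s
    | h_x e i j r s =>
      rw [map_sub, map_sub, map_smul, hl, hl, map_add, map_mul f, map_mul f]
      exact .h_x e i j r s
    | x_x e i j r s =>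
      rw [map_sub, map_sub, map_smul, hl, hl, map_add, map_mul f, map_mul f]
      exact .x_x e i j r s
    | serre e i j hij r s => simp only [map_sum, hn]; exact .serre e i j hij r s

theorem Presented.relator_eq_zero {b : Presented D hbar K}
    (hb : Relator D hbar (Presented.gen D hbar K) b) : b = 0 := by
  obtain ⟨a, ha, rfl⟩ := (relator_map_iff (RingQuot.mkAlgHom R
    (fun a b : FreeAlgebra R (Gen I H K) => Relator D hbar (FreeAlgebra.ι R) a ∧ b = 0))
    (g := FreeAlgebra.ι R)).1 hb
  rw [RingQuot.mkAlgHom_rel R (s := fun a b : FreeAlgebra R (Gen I H K) =>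
    Relator D hbar (FreeAlgebra.ι R) a ∧ b = 0) (y := 0) ⟨ha, rfl⟩, map_zero]
  rfl

/-- The homomorphism defined on generators by a family that satisfies the relations. -/
noncomputable def Presented.lift {B : Type*} [Ring B] [Algebra R B] (g : Gen I H K → B)
    (hg : ∀ b, Relator D hbar g b → b = 0) : Presented D hbar K →ₐ[R] B :=
  RingQuot.liftAlgHom R ⟨FreeAlgebra.lift R g, by
    rintro a b ⟨ha, rfl⟩
    have := hg (FreeAlgebra.lift R g a) (by
      simpa using (relator_map_iff (FreeAlgebra.lift R g) (g := FreeAlgebra.ι R)).2 ⟨a, ha, rfl⟩)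
    rw [this, map_zero]⟩

theorem Presented.lift_gen {B : Type*} [Ring B] [Algebra R B] (g : Gen I H K → B)
    (hg : ∀ b, Relator D hbar g b → b = 0) (y : Gen I H K) :
    Presented.lift g hg (Presented.gen D hbar K y) = g y := by
  unfold Presented.lift Presented.gen
  exact (RingQuot.liftAlgHom_mkAlgHom_apply R _ _ _).trans (FreeAlgebra.lift_ι_apply _ _)

end Presentation

section Completion

instance isTwoSided_span_algebraMap {R A : Type*} [CommRing R] [Ring A] [Algebra R A] (r : R) :
    (Ideal.span {algebraMap R A r}).IsTwoSided := ⟨by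
  intro a b ha
  obtain ⟨c, rfl⟩ := Ideal.mem_span_singleton'.1 ha
  exact Ideal.mem_span_singleton'.2 ⟨c * b, by rw [mul_assoc, mul_assoc, Algebra.commutes]⟩⟩

/-- The completion `lim_n A / I ^ n` of a (not necessarily commutative) `R`-algebra `A` with respect
to the powers of a two-sided ideal `I`, as the algebra of compatible sequences. -/
def adicCompletion (R : Type*) {A : Type*} [CommRing R] [Ring A] [Algebra R A] (I : Ideal A)
    [I.IsTwoSided] : Subalgebra R (∀ n : ℕ, A ⧸ I ^ n) where
  carrier := {f | ∀ m n (hmn : m ≤ n),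
    Ideal.Quotient.factorₐ R (Ideal.pow_le_pow_right (I := I) hmn) (f n) = f m}
  mul_mem' := fun {f g} hf hg m n hmn => by
    rw [Pi.mul_apply, map_mul, hf m n hmn, hg m n hmn, Pi.mul_apply]
  add_mem' := fun {f g} hf hg m n hmn => by
    rw [Pi.add_apply, map_add, hf m n hmn, hg m n hmn, Pi.add_apply]
  algebraMap_mem' := fun r m n hmn => by simp

/-- The projection `lim_k A / I ^ k → A / I ^ n`. -/
def adicCompletion.proj (R : Type*) {A : Type*} [CommRing R] [Ring A] [Algebra R A] (I : Ideal A)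
    [I.IsTwoSided] (n : ℕ) : adicCompletion R I →ₐ[R] A ⧸ I ^ n :=
  (Pi.evalAlgHom R (fun n : ℕ => A ⧸ I ^ n) n).comp (adicCompletion R I).val

/-- The canonical homomorphism `A → lim_n A / I ^ n`. -/
def adicCompletion.of (R : Type*) {A : Type*} [CommRing R] [Ring A] [Algebra R A] (I : Ideal A)
    [I.IsTwoSided] : A →ₐ[R] adicCompletion R I :=
  (AlgHom.pi fun n => Ideal.Quotient.mkₐ R (I ^ n)).codRestrict _
    fun _ _ _ _ => rfl

end Completion

section YangianDouble

variable {I H : Type*} [Fintype I] [DecidableEq I] [AddCommGroup H] [Module ℂ H]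
variable (D : CartanRealization I H)

/-- The `ℂ⟦ħ⟧`-algebra with the generators and relations of the Yangian double, before completion. -/
abbrev PreDouble : Type _ := Presented D (PowerSeries.X : ℂ⟦X⟧) ℤ

/-- The two-sided ideal generated by `ħ`; its `n`-th power consists of the multiples of `ħ ^ n`. -/
noncomputable abbrev hbarIdeal : Ideal (PreDouble D) := Ideal.span {algebraMap ℂ⟦X⟧ (PreDouble D) PowerSeries.X}

/-- The Yangian double: the `ℂ⟦ħ⟧`-algebra topologically generated by `𝔥`, `X_{i,r}^±`, `H_{i,r}`
(`r ∈ ℤ`) subject to the defining relations, that is, the separated and complete (for the `ħ`-adic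
topology) algebra obtained by completing the presented algebra `ħ`-adically. -/
noncomputable def Double : Type _ := adicCompletion ℂ⟦X⟧ (hbarIdeal D)

noncomputable instance : Ring (Double D) :=
  inferInstanceAs (Ring (adicCompletion ℂ⟦X⟧ (hbarIdeal D)))

noncomputable instance : Algebra ℂ⟦X⟧ (Double D) :=
  inferInstanceAs (Algebra ℂ⟦X⟧ (adicCompletion ℂ⟦X⟧ (hbarIdeal D)))

noncomputable instance : Algebra ℂ[X] (Double D) :=
  Algebra.compHom (Double D) (Polynomial.coeToPowerSeries.ringHom : ℂ[X] →+* ℂ⟦X⟧)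

/-- The canonical homomorphism from the presented algebra to its completion. -/
noncomputable def Double.of : PreDouble D →ₐ[ℂ⟦X⟧] Double D :=
  adicCompletion.of ℂ⟦X⟧ (hbarIdeal D)

/-- The topological generators of the Yangian double. -/
noncomputable def Double.gen (y : Gen I H ℤ) : Double D :=
  Double.of D (Presented.gen D PowerSeries.X ℤ y)

/-- The Yangian, a `ℂ[ħ]`-algebra. -/
noncomputable abbrev Yangian : Type _ := Presented D (Polynomial.X : ℂ[X]) ℕ

/-- The generators of the Yangian. -/
noncomputable abbrev Yangian.gen (y : Gen I H ℕ) : Yangian D := Presented.gen D Polynomial.X ℕ y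

/-- The inclusion of the generator symbols with modes in `ℕ` into those with modes in `ℤ`. -/
def Gen.toInt : Gen I H ℕ → Gen I H ℤ
  | .cart a => .cart a
  | .x e i r => .x e i r
  | .h i r => .h i r

theorem Double.relator_eq_zero {b : Double D}
    (hb : Relator D (PowerSeries.X : ℂ⟦X⟧) (Double.gen D) b) : b = 0 := by
  obtain ⟨a, ha, rfl⟩ := (relator_map_iff (Double.of D) (g := Presented.gen D PowerSeries.X ℤ)).1 hb
  rw [Presented.relator_eq_zero ha]
  exact map_zero _

theorem Double.relator_toInt {b : Double D}
    (hb : Relator D (Polynomial.X : ℂ[X]) (fun y => Double.gen D (Gen.toInt y)) b) :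
    Relator D (PowerSeries.X : ℂ⟦X⟧) (Double.gen D) b := by
  have hs : ∀ (p : ℂ[X]) (y : Double D), p • y = (p : ℂ⟦X⟧) • y := fun _ _ => rfl
  have hc : ∀ c : ℂ, ((algebraMap ℂ ℂ[X] c : ℂ[X]) : ℂ⟦X⟧) = algebraMap ℂ ℂ⟦X⟧ c := by
    intro c; simp
  cases hb with
  | cart_add a b => exact .cart_add _ _
  | cart_smul c a => rw [hs, hc]; exact .cart_smul _ _
  | h_zero i => exact .h_zero _
  | h_h i j r s => exact .h_h _ _ _ _
  | h_cart i r a => exact .h_cart _ _ _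
  | cart_cart a b => exact .cart_cart _ _
  | cart_x a e j s => rw [hs, hc]; exact .cart_x _ _ _ _
  | x_x_neg i j r s => 
    have := Relator.x_x_neg (D := D) (hbar := (PowerSeries.X : ℂ⟦X⟧)) (g := Double.gen D) i j r s
    simpa [Gen.toInt] using this
  | h_x e i j r s =>
    rw [hs, Polynomial.coe_mul, hc, Polynomial.coe_X]; exact .h_x e i j (r : ℤ) (s : ℤ)
  | x_x e i j r s =>
    rw [hs, Polynomial.coe_mul, hc, Polynomial.coe_X]; exact .x_x e i j (r : ℤ) (s : ℤ)
  | serre e i j hij r s => exact .serre e i j hij (fun k => (r k : ℤ)) (s : ℤ)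

/-- The natural homomorphism `ι` from the Yangian to the Yangian double. -/
noncomputable def iota : Yangian D →ₐ[ℂ[X]] Double D :=
  Presented.lift (fun y => Double.gen D (Gen.toInt y)) fun _ hb =>
    Double.relator_eq_zero D (Double.relator_toInt D hb)

end YangianDouble

section Shift

variable {I H : Type*} [Fintype I] [DecidableEq I] [AddCommGroup H] [Module ℂ H]
variable (D : CartanRealization I H) {R : Type*} [CommRing R] [Algebra ℂ R] {hbar : R}
  {B : Type*} [Ring B] [Algebra R B]

/-- The family `h ↦ h`, `x_{i,r} ↦ ∑_k (r choose k) c^{r-k} x_{i,k}`, and likewise for `h_{i,r}`. -/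
noncomputable def shiftFamily (c : R) (g : Gen I H ℕ → B) : Gen I H ℕ → B
  | .cart a => g (.cart a)
  | .x e i r => ∑ k ∈ Finset.range (r + 1), ((r.choose k : R) * c ^ (r - k)) • g (.x e i k)
  | .h i r => ∑ k ∈ Finset.range (r + 1), ((r.choose k : R) * c ^ (r - k)) • g (.h i k)

/-- Linear extension of a sequence `t ^ r ↦ f r` to polynomials in `t`. -/
noncomputable def polyExt (f : ℕ → B) : R[X] →ₗ[R] B := (Polynomial.basisMonomials R).constr R f

theorem polyExt_monomial (f : ℕ → B) (r : ℕ) : polyExt f (Polynomial.monomial r (1 : R)) = f r := by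
  have := (Polynomial.basisMonomials R).constr_basis R f r
  simpa [polyExt] using this

theorem polyExt_shift (f : ℕ → B) (c : R) (r : ℕ) :
    polyExt f ((Polynomial.X + Polynomial.C c) ^ r) =
      ∑ k ∈ Finset.range (r + 1), ((r.choose k : R) * c ^ (r - k)) • f k := by
  rw [add_pow, map_sum]
  refine Finset.sum_congr rfl fun k _ => ?_
  rw [← polyExt_monomial (R := R) f k, ← map_smul]
  congr 1
  rw [← Polynomial.C_pow, Polynomial.smul_eq_C_mul, Polynomial.C_mul, ← Polynomial.X_pow_eq_monomial]
  simp only [map_natCast]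
  ring

theorem poly_bilin_ext {F G : R[X] →ₗ[R] R[X] →ₗ[R] B}
    (h : ∀ r s, F (Polynomial.monomial r 1) (Polynomial.monomial s 1) =
      G (Polynomial.monomial r 1) (Polynomial.monomial s 1)) : F = G := by
  refine (Polynomial.basisMonomials R).ext fun r => (Polynomial.basisMonomials R).ext fun s => ?_
  simpa using h r s

/-- The left multiplication by commutators, `a ↦ (b ↦ [a, b])`. -/
def commutatorMap (R B : Type*) [CommRing R] [Ring B] [Algebra R B] : B →ₗ[R] Module.End R B :=
  LinearMap.mul R B - (LinearMap.mul R B).flip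

theorem commutatorMap_apply (a b : B) : commutatorMap R B a b = ⁅a, b⁆ := rfl

theorem nest_eq {m : ℕ} (y : Fin m → B) (z : B) :
    nest y z = (List.ofFn fun k => commutatorMap R B (y k)).prod z := by
  have key : ∀ l : List B, l.foldr (fun a b => ⁅a, b⁆) z =
      (l.map fun a => commutatorMap R B a).prod z := by
    intro l
    induction l with
    | nil => rfl
    | cons a l ih => rw [List.foldr_cons, ih]; rfl
  rw [nest, key, List.map_ofFn]; rfl

theorem serre_poly {m : ℕ} (X Z : ℕ → B)
    (hS : ∀ (r : Fin m → ℕ) (s : ℕ),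
      ∑ p : Equiv.Perm (Fin m), nest (fun k => X (r (p k))) (Z s) = 0)
    (P : Fin m → R[X]) (Q : R[X]) :
    ∑ p : Equiv.Perm (Fin m), nest (fun k => polyExt X (P (p k))) (polyExt Z Q) = 0 := by
  let L : R[X] →ₗ[R] Module.End R B := commutatorMap R B ∘ₗ polyExt X
  let M : MultilinearMap R (fun _ : Fin m => R[X]) (Module.End R B) :=
    ∑ p : Equiv.Perm (Fin m),
      (((MultilinearMap.mkPiAlgebraFin R m (Module.End R B)).compLinearMap fun _ => L).domDomCongr p)
  have hM : ∀ (P : Fin m → R[X]) (z : B), M P z =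
      ∑ p : Equiv.Perm (Fin m), nest (fun k => polyExt X (P (p k))) z := by
    intro P z
    simp only [M, _root_.sum_apply, LinearMap.sum_apply, nest_eq (R := R)]
    rfl
  have h0 : ∀ r : Fin m → ℕ, M (fun i => Polynomial.basisMonomials R (r i)) ∘ₗ polyExt Z = 0 := by
    intro r
    refine (Polynomial.basisMonomials R).ext fun s => ?_
    simp only [LinearMap.comp_apply, hM, Polynomial.coe_basisMonomials, polyExt_monomial]
    simpa using hS r s
  let N : MultilinearMap R (fun _ : Fin m => R[X]) B :=
    (LinearMap.applyₗ (polyExt Z Q) : Module.End R B →ₗ[R] B).compMultilinearMap M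
  have hN : N = 0 := by
    refine Module.Basis.ext_multilinear (fun _ => Polynomial.basisMonomials R) fun r => ?_
    exact LinearMap.congr_fun (h0 r) Q
  rw [← hM]
  exact congrFun (congrArg DFunLike.coe hN) P

theorem shiftFamily_relator (c : R) {g : Gen I H ℕ → B} (hg : ∀ b, Relator D hbar g b → b = 0)
    {b : B} (hb : Relator D hbar (shiftFamily c g) b) : b = 0 := by
  set T : R[X] := Polynomial.X + Polynomial.C c with hT
  have hx : ∀ e i r, shiftFamily c g (.x e i r) = polyExt (fun k => g (.x e i k)) (T ^ r) :=
    fun e i r => (polyExt_shift _ c r).symm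
  have hh : ∀ i r, shiftFamily c g (.h i r) = polyExt (fun k => g (.h i k)) (T ^ r) :=
    fun i r => (polyExt_shift _ c r).symm
  have hc : ∀ a, shiftFamily c g (.cart a) = g (.cart a) := fun _ => rfl
  have mulXT : ∀ p q : R[X], ∀ (f f' : ℕ → B),
      ⁅polyExt f (T * p), polyExt f' q⁆ - ⁅polyExt f p, polyExt f' (T * q)⁆ =
      ⁅polyExt f (Polynomial.X * p), polyExt f' q⁆ - ⁅polyExt f p, polyExt f' (Polynomial.X * q)⁆ := by
    intro p q f f'
    simp only [hT, add_mul, map_add, ← Polynomial.smul_eq_C_mul, map_smul, Ring.lie_def,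
      mul_add, smul_mul_assoc, mul_smul_comm]
    abel
  -- the quadratic relations, extended bilinearly
  have quad : ∀ (κ : R) (f f' : ℕ → B),
      (∀ r s, ⁅f (r + 1), f' s⁆ - ⁅f r, f' (s + 1)⁆ = κ • (f r * f' s + f' s * f r)) →
      ∀ p q : R[X], ⁅polyExt f (Polynomial.X * p), polyExt f' q⁆ -
        ⁅polyExt f p, polyExt f' (Polynomial.X * q)⁆ =
        κ • (polyExt f p * polyExt f' q + polyExt f' q * polyExt f p) := by
    intro κ f f' hf p q
    let C := commutatorMap R B
    let mX : R[X] →ₗ[R] R[X] := LinearMap.mulLeft R Polynomial.X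
    let A := LinearMap.mul R B + (LinearMap.mul R B).flip
    have := poly_bilin_ext
      (F := C.compl₁₂ (polyExt f ∘ₗ mX) (polyExt f') - C.compl₁₂ (polyExt f) (polyExt f' ∘ₗ mX))
      (G := κ • A.compl₁₂ (polyExt f) (polyExt f')) (by
        intro r s
        have h1 : ∀ r : ℕ, mX (Polynomial.monomial r 1) = Polynomial.monomial (r + 1) 1 := by
          intro r; simp [mX, Polynomial.X_mul_monomial]
        simp only [LinearMap.sub_apply, LinearMap.smul_apply, LinearMap.compl₁₂_apply,
          LinearMap.comp_apply, h1, polyExt_monomial]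
        exact hf r s)
    exact LinearMap.congr_fun (LinearMap.congr_fun this p) q
  cases hb with
  | cart_add a b => exact hg _ (.cart_add a b)
  | cart_smul c a => exact hg _ (.cart_smul c a)
  | h_zero i =>
    have := hg _ (.h_zero i)
    simpa [shiftFamily] using this
  | h_h i j r s =>
    rw [hh, hh]
    have := poly_bilin_ext (R := R) (F := (commutatorMap R B).compl₁₂
      (polyExt fun k => g (.h i k)) (polyExt fun k => g (.h j k))) (G := 0) (by
        intro r s
        simp only [LinearMap.compl₁₂_apply, polyExt_monomial]
        exact hg _ (.h_h i j r s))
    exact LinearMap.congr_fun (LinearMap.congr_fun this _) _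
  | h_cart i r a =>
    rw [hh, hc]
    have : (commutatorMap R B).flip (g (.cart a)) ∘ₗ (polyExt fun k => g (.h i k)) = 0 := by
      refine (Polynomial.basisMonomials R).ext fun r => ?_
      simp only [LinearMap.comp_apply, Polynomial.coe_basisMonomials, polyExt_monomial]
      exact hg _ (.h_cart i r a)
    exact LinearMap.congr_fun this _
  | cart_cart a b => exact hg _ (.cart_cart a b)
  | cart_x a e j s =>
    rw [hx, hc, sub_eq_zero]
    have : commutatorMap R B (g (.cart a)) ∘ₗ (polyExt fun k => g (.x e j k)) =
        algebraMap ℂ R (((e : ℤ) : ℂ) * D.root j a) • (polyExt fun k => g (.x e j k)) := by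
      refine (Polynomial.basisMonomials R).ext fun r => ?_
      simp only [LinearMap.comp_apply, LinearMap.smul_apply, Polynomial.coe_basisMonomials,
        polyExt_monomial]
      exact sub_eq_zero.1 (hg _ (.cart_x a e j r))
    exact LinearMap.congr_fun this _
  | x_x_neg i j r s =>
    rw [hx, hx, hh, sub_eq_zero]
    have := poly_bilin_ext (R := R) (F := (commutatorMap R B).compl₁₂
      (polyExt fun k => g (.x 1 i k)) (polyExt fun k => g (.x (-1) j k)))
      (G := if i = j then
        (LinearMap.mul R R[X]).compr₂ (polyExt fun k => g (.h i k)) else 0) (by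
        intro r s
        simp only [LinearMap.compl₁₂_apply, polyExt_monomial, commutatorMap_apply]
        rw [sub_eq_zero.1 (hg _ (.x_x_neg i j r s))]
        split_ifs
        · simp [Polynomial.monomial_mul_monomial, polyExt_monomial]
        · rfl)
    have := LinearMap.congr_fun (LinearMap.congr_fun this (T ^ r)) (T ^ s)
    simp only [LinearMap.compl₁₂_apply, commutatorMap_apply] at this
    rw [this]
    split_ifs
    · simp [pow_add]
    · rfl
  | h_x e i j r s =>
    rw [hx, hx, hh, hh, pow_succ', pow_succ', mulXT, sub_eq_zero]
    exact quad _ _ _ (fun r s => sub_eq_zero.1 (hg _ (.h_x e i j r s))) _ _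
  | x_x e i j r s =>
    rw [hx, hx, hx, hx, pow_succ', pow_succ', mulXT, sub_eq_zero]
    exact quad _ _ _ (fun r s => sub_eq_zero.1 (hg _ (.x_x e i j r s))) _ _
  | serre e i j hij r s =>
    simp only [hx]
    exact serre_poly _ _ (fun r s => hg _ (.serre e i j hij r s)) (fun k => T ^ r k) (T ^ s)

/-- The shift homomorphism `τ_c` of the Yangian. -/
noncomputable def shift (c : ℂ) : Yangian D →ₐ[ℂ[X]] Yangian D :=
  Presented.lift (shiftFamily (algebraMap ℂ ℂ[X] c) (Yangian.gen D)) fun _ hb =>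
    shiftFamily_relator D _ (fun _ hb => Presented.relator_eq_zero hb) hb

end Shift

section CompletedYangian

variable {I H : Type*} [Fintype I] [DecidableEq I] [AddCommGroup H] [Module ℂ H]
variable (D : CartanRealization I H)

/-- `IsMonomial D n y`: the element `y` is a product of generators and of copies of `ħ`, of total
degree `n`, where `deg ħ = 1`, `deg 𝔥 = 0` and `deg x_{i,r} = deg h_{i,r} = r`. -/
inductive Yangian.IsMonomial : ℕ → Yangian D → Prop
  | one : Yangian.IsMonomial 0 1
  | hbar {n : ℕ} {y : Yangian D} (hy : Yangian.IsMonomial n y) :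
      Yangian.IsMonomial (1 + n) (algebraMap ℂ[X] (Yangian D) Polynomial.X * y)
  | cart {n : ℕ} {y : Yangian D} (a : H) (hy : Yangian.IsMonomial n y) :
      Yangian.IsMonomial n (Yangian.gen D (.cart a) * y)
  | x {n : ℕ} {y : Yangian D} (e : ℤˣ) (i : I) (r : ℕ) (hy : Yangian.IsMonomial n y) :
      Yangian.IsMonomial (r + n) (Yangian.gen D (.x e i r) * y)
  | h {n : ℕ} {y : Yangian D} (i : I) (r : ℕ) (hy : Yangian.IsMonomial n y) :
      Yangian.IsMonomial (r + n) (Yangian.gen D (.h i r) * y)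

/-- The graded component of degree `k` of the Yangian. -/
noncomputable def Yangian.grade (k : ℕ) : Submodule ℂ (Yangian D) :=
  Submodule.span ℂ {y | Yangian.IsMonomial D k y}

theorem Yangian.IsMonomial.mul {m n : ℕ} {a b : Yangian D} (ha : Yangian.IsMonomial D m a)
    (hb : Yangian.IsMonomial D n b) : Yangian.IsMonomial D (m + n) (a * b) := by
  induction ha with
  | one => simpa using hb
  | hbar _ ih => rw [mul_assoc, add_assoc]; exact .hbar ih
  | cart a _ ih => rw [mul_assoc]; exact .cart a ih
  | x e i r _ ih => rw [mul_assoc, add_assoc]; exact .x e i r ih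
  | h i r _ ih => rw [mul_assoc, add_assoc]; exact .h i r ih

theorem Yangian.mul_mem_grade {m n : ℕ} {a b : Yangian D} (ha : a ∈ Yangian.grade D m)
    (hb : b ∈ Yangian.grade D n) : a * b ∈ Yangian.grade D (m + n) := by
  have := Submodule.mul_mem_mul ha hb
  rw [Yangian.grade, Yangian.grade, Submodule.span_mul_span] at this
  refine Submodule.span_mono ?_ this
  rintro _ ⟨a, ha, b, hb, rfl⟩
  exact Yangian.IsMonomial.mul D ha hb

theorem Yangian.cart_mem (a : H) : Yangian.gen D (.cart a) ∈ Yangian.grade D 0 :=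
  Submodule.subset_span (by simpa using Yangian.IsMonomial.cart a .one)

theorem Yangian.x_mem (e : ℤˣ) (i : I) (r : ℕ) : Yangian.gen D (.x e i r) ∈ Yangian.grade D r :=
  Submodule.subset_span (by simpa using Yangian.IsMonomial.x e i r .one)

theorem Yangian.h_mem (i : I) (r : ℕ) : Yangian.gen D (.h i r) ∈ Yangian.grade D r :=
  Submodule.subset_span (by simpa using Yangian.IsMonomial.h i r .one)

theorem Yangian.hbar_pow_mem (k : ℕ) :
    algebraMap ℂ[X] (Yangian D) (Polynomial.X ^ k) ∈ Yangian.grade D k := by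
  refine Submodule.subset_span ?_
  induction k with
  | zero => simpa using Yangian.IsMonomial.one
  | succ k ih =>
    rw [pow_succ', map_mul, add_comm]
    exact .hbar ih

/-- The product `∏_k Y_k` of the graded components of the Yangian with its convolution product,
realized as the ring of the power series `∑_k y_k z^k` with `y_k ∈ Y_k`. -/
noncomputable def completedSubring : Subring (Yangian D)⟦X⟧ where
  carrier := {f | ∀ k, PowerSeries.coeff k f ∈ Yangian.grade D k}
  mul_mem' := fun {f g} hf hg k => by
    rw [PowerSeries.coeff_mul]
    refine Submodule.sum_mem _ fun p hp => ?_
    exact (Finset.HasAntidiagonal.mem_antidiagonal.1 hp) ▸ Yangian.mul_mem_grade D (hf p.1) (hg p.2)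
  one_mem' := fun k => by
    rw [PowerSeries.coeff_one]
    split_ifs with h
    · subst h; simpa using Yangian.hbar_pow_mem D 0
    · exact Submodule.zero_mem _
  add_mem' := fun hf hg k => by rw [map_add]; exact Submodule.add_mem _ (hf k) (hg k)
  zero_mem' := fun k => by rw [map_zero]; exact Submodule.zero_mem _
  neg_mem' := fun hf k => by rw [map_neg]; exact Submodule.neg_mem _ (hf k)

/-- The scalar `∑_k a_k ħ^k`, as the series with `k`-th component `a_k ħ^k`. -/
noncomputable def scalarSeries : ℂ⟦X⟧ →+* (Yangian D)⟦X⟧ :=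
  (PowerSeries.map (algebraMap ℂ[X] (Yangian D))).comp
    ((PowerSeries.rescale (Polynomial.X : ℂ[X])).comp (PowerSeries.map Polynomial.C))

theorem coeff_scalarSeries (k : ℕ) (f : ℂ⟦X⟧) :
    PowerSeries.coeff k (scalarSeries D f) =
      PowerSeries.coeff k f • algebraMap ℂ[X] (Yangian D) (Polynomial.X ^ k) := by
  simp only [scalarSeries, RingHom.comp_apply, PowerSeries.coeff_map, PowerSeries.coeff_rescale]
  rw [mul_comm, ← Polynomial.smul_eq_C_mul, Algebra.algebraMap_eq_smul_one,
    Algebra.algebraMap_eq_smul_one, smul_assoc]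

/-- The completion `∏_k Y_k` of the Yangian with respect to its `ℕ`-grading. -/
def CompletedYangian : Type _ := completedSubring D

noncomputable instance : Ring (CompletedYangian D) := inferInstanceAs (Ring (completedSubring D))

/-- The structure map `ℂ⟦ħ⟧ → ∏_k Y_k`, where `ħ` is the element `ħ` of `Y_1`. -/
noncomputable def CompletedYangian.scalar : ℂ⟦X⟧ →+* CompletedYangian D :=
  (scalarSeries D).codRestrict (completedSubring D) fun f k => by
    rw [coeff_scalarSeries]
    exact Submodule.smul_mem _ _ (Yangian.hbar_pow_mem D k)

/-- The component of degree `k`. -/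
noncomputable def CompletedYangian.comp (k : ℕ) : CompletedYangian D →+ Yangian D :=
  (PowerSeries.coeff k : (Yangian D)⟦X⟧ →ₗ[Yangian D] Yangian D).toAddMonoidHom.comp
    (completedSubring D).subtype.toAddMonoidHom

noncomputable instance : Algebra ℂ⟦X⟧ (CompletedYangian D) :=
  (CompletedYangian.scalar D).toAlgebra' fun c x => by
    refine Subtype.ext (PowerSeries.ext fun k => ?_)
    change PowerSeries.coeff k (scalarSeries D c * x.1) = PowerSeries.coeff k (x.1 * scalarSeries D c)
    rw [PowerSeries.coeff_mul, PowerSeries.coeff_mul, ← Finset.Nat.sum_antidiagonal_swap]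
    refine Finset.sum_congr rfl fun p _ => ?_
    simp only [coeff_scalarSeries, Prod.fst_swap, Prod.snd_swap, smul_mul_assoc, mul_smul_comm,
      Algebra.commutes]

noncomputable instance : Algebra ℂ[X] (CompletedYangian D) :=
  Algebra.compHom (CompletedYangian D) (Polynomial.coeToPowerSeries.ringHom : ℂ[X] →+* ℂ⟦X⟧)

/-- A homogeneous element of degree `k` as an element of the completion. -/
noncomputable def CompletedYangian.single (k : ℕ) (y : Yangian D) (hy : y ∈ Yangian.grade D k) :
    CompletedYangian D :=
  ⟨PowerSeries.monomial k y, fun n => by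
    rw [PowerSeries.coeff_monomial]
    split_ifs with h
    · exact h ▸ hy
    · exact Submodule.zero_mem _⟩

/-- The generators of the Yangian as elements of its completion. -/
noncomputable def CompletedYangian.gen : Gen I H ℕ → CompletedYangian D
  | .cart a => single D 0 _ (Yangian.cart_mem D a)
  | .x e i r => single D r _ (Yangian.x_mem D e i r)
  | .h i r => single D r _ (Yangian.h_mem D i r)

theorem CompletedYangian.smul_val (f : ℂ⟦X⟧) (y : CompletedYangian D) :
    (f • y).1 = scalarSeries D f * y.1 := rfl

theorem rescale_C_eq {A : Type*} [CommSemiring A] (a b : A) :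
    PowerSeries.rescale a (PowerSeries.C b) = PowerSeries.C b := by
  ext k
  rw [PowerSeries.coeff_rescale, PowerSeries.coeff_C]
  split_ifs with h <;> simp [h]

theorem CompletedYangian.smul_C_val (c : ℂ) (y : CompletedYangian D) :
    (algebraMap ℂ ℂ[X] c • y).1 = algebraMap ℂ ℂ[X] c • y.1 := by
  have h0 : (algebraMap ℂ ℂ[X] c • y).1 =
      scalarSeries D ((algebraMap ℂ ℂ[X] c : ℂ[X]) : ℂ⟦X⟧) * y.1 := rfl
  have h1 : scalarSeries D ((algebraMap ℂ ℂ[X] c : ℂ[X]) : ℂ⟦X⟧) =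
      PowerSeries.C (algebraMap ℂ[X] (Yangian D) (algebraMap ℂ ℂ[X] c)) := by
    simp [scalarSeries, rescale_C_eq]
  ext k
  rw [h0, h1, PowerSeries.coeff_C_mul, PowerSeries.coeff_smul, Algebra.smul_def]

theorem CompletedYangian.smul_C_mul_X_val (c : ℂ) (y : CompletedYangian D) :
    ((algebraMap ℂ ℂ[X] c * Polynomial.X) • y).1 =
      (algebraMap ℂ ℂ[X] c * Polynomial.X) • (PowerSeries.X * y.1) := by
  have h0 : ((algebraMap ℂ ℂ[X] c * Polynomial.X) • y).1 =
      scalarSeries D ((algebraMap ℂ ℂ[X] c * Polynomial.X : ℂ[X]) : ℂ⟦X⟧) * y.1 := rfl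
  have h1 : scalarSeries D ((algebraMap ℂ ℂ[X] c * Polynomial.X : ℂ[X]) : ℂ⟦X⟧) =
      PowerSeries.C (algebraMap ℂ[X] (Yangian D) (algebraMap ℂ ℂ[X] c * Polynomial.X)) *
        PowerSeries.X := by
    simp [scalarSeries, rescale_C_eq, mul_assoc]
  ext k
  rw [h0, h1, mul_assoc, PowerSeries.coeff_C_mul, PowerSeries.coeff_smul, Algebra.smul_def]

theorem monomial_nest {A : Type*} [Ring A] {m : ℕ} (n : Fin m → ℕ) (y : Fin m → A) (l : ℕ) (z : A) :
    nest (fun k => PowerSeries.monomial (n k) (y k)) (PowerSeries.monomial l z) =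
      PowerSeries.monomial (∑ k, n k + l) (nest y z) := by
  induction m with
  | zero => simp [nest]
  | succ m ih =>
    have h1 : ∀ {B : Type _} [Ring B] (y : Fin (m + 1) → B) (z : B),
        nest y z = ⁅y 0, nest (fun k => y k.succ) z⁆ := by
      intro B _ y z; simp [nest, List.ofFn_succ]
    have h2 : ∀ (y : Fin (m + 1) → A) (z : A),
        nest y z = ⁅y 0, nest (fun k => y k.succ) z⁆ := by
      intro y z; simp [nest, List.ofFn_succ]
    rw [h1, ih, h2, Ring.lie_def, Ring.lie_def, PowerSeries.monomial_mul_monomial,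
      PowerSeries.monomial_mul_monomial, map_sub, Fin.sum_univ_succ,
      add_comm (∑ k : Fin m, n k.succ + l) (n 0), add_assoc]

theorem CompletedYangian.relator_eq_zero {b : CompletedYangian D}
    (hb : Relator D (Polynomial.X : ℂ[X]) (CompletedYangian.gen D) b) : b = 0 := by
  have hY : ∀ {b : Yangian D}, Relator D (Polynomial.X : ℂ[X]) (Yangian.gen D) b → b = 0 :=
    fun hb => Presented.relator_eq_zero hb
  have hlie : ∀ (m n : ℕ) (a b : Yangian D),
      ⁅(PowerSeries.monomial m a : (Yangian D)⟦X⟧), PowerSeries.monomial n b⁆ =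
        PowerSeries.monomial (m + n) ⁅a, b⁆ := by
    intro m n a b
    rw [Ring.lie_def, PowerSeries.monomial_mul_monomial, PowerSeries.monomial_mul_monomial,
      add_comm n m, Ring.lie_def, map_sub]
  have hsmul : ∀ (p : ℂ[X]) (n : ℕ) (a : Yangian D),
      p • (PowerSeries.monomial n a : (Yangian D)⟦X⟧) = PowerSeries.monomial n (p • a) := by
    intro p n a
    ext k
    simp only [PowerSeries.coeff_smul, PowerSeries.coeff_monomial]
    split_ifs <;> simp
  have hX : ∀ (n : ℕ) (a : Yangian D), PowerSeries.X * (PowerSeries.monomial n a : (Yangian D)⟦X⟧) =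
      PowerSeries.monomial (n + 1) a := by
    intro n a
    rw [PowerSeries.X_eq, PowerSeries.monomial_mul_monomial, one_mul, add_comm]
  have hl : ∀ a b : CompletedYangian D, (⁅a, b⁆ : CompletedYangian D).1 = ⁅a.1, b.1⁆ :=
    fun _ _ => rfl
  have hs : ∀ a b : CompletedYangian D, (a - b).1 = a.1 - b.1 := fun _ _ => rfl
  have ha : ∀ a b : CompletedYangian D, (a + b).1 = a.1 + b.1 := fun _ _ => rfl
  have hm : ∀ a b : CompletedYangian D, (a * b).1 = a.1 * b.1 := fun _ _ => rfl
  have hgc : ∀ a, (CompletedYangian.gen D (.cart a)).1 =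
    PowerSeries.monomial 0 (Yangian.gen D (.cart a)) := fun _ => rfl
  have hgx : ∀ e i r, (CompletedYangian.gen D (.x e i r)).1 =
    PowerSeries.monomial r (Yangian.gen D (.x e i r)) := fun _ _ _ => rfl
  have hgh : ∀ i r, (CompletedYangian.gen D (.h i r)).1 =
    PowerSeries.monomial r (Yangian.gen D (.h i r)) := fun _ _ => rfl
  have fin : ∀ (n : ℕ) {y : Yangian D}, Relator D (Polynomial.X : ℂ[X]) (Yangian.gen D) y →
      (PowerSeries.monomial n y : (Yangian D)⟦X⟧) = 0 := by
    intro n y hy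
    rw [hY hy, map_zero]
  refine Subtype.ext ?_
  change b.1 = 0
  cases hb with
  | cart_add a b =>
    simp only [hs, ha, hgc, ← map_add, ← map_sub]
    exact fin _ (.cart_add a b)
  | cart_smul c a =>
    simp only [hs, CompletedYangian.smul_C_val, hgc, hsmul, ← map_sub]
    exact fin _ (.cart_smul c a)
  | h_zero i =>
    simp only [hs, hgc, hgh, ← map_sub]
    exact fin _ (.h_zero i)
  | h_h i j r s => rw [hl, hgh, hgh, hlie]; exact fin _ (.h_h i j r s)
  | h_cart i r a => rw [hl, hgh, hgc, hlie]; exact fin _ (.h_cart i r a)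
  | cart_cart a b => rw [hl, hgc, hgc, hlie]; exact fin _ (.cart_cart a b)
  | cart_x a e j s =>
    simp only [hs, hl, CompletedYangian.smul_C_val, hgc, hgx, hsmul, hlie, zero_add, ← map_sub]
    exact fin _ (.cart_x a e j s)
  | x_x_neg i j r s =>
    have h0 : (if i = j then CompletedYangian.gen D (.h i (r + s)) else 0).1 =
        PowerSeries.monomial (r + s) (if i = j then Yangian.gen D (.h i (r + s)) else 0) := by
      split_ifs
      · rfl
      · rw [map_zero]; rfl
    rw [hs, hl, hgx, hgx, hlie, h0, ← map_sub]
    exact fin _ (.x_x_neg i j r s)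
  | h_x e i j r s =>
    rw [hs, hs, hl, hl, CompletedYangian.smul_C_mul_X_val, ha, hm, hm]
    simp only [hgx, hgh, hlie, PowerSeries.monomial_mul_monomial]
    rw [add_comm s r, ← map_add, hX, hsmul, add_right_comm r 1 s, ← add_assoc r s 1, ← map_sub,
      ← map_sub]
    exact fin _ (.h_x e i j r s)
  | x_x e i j r s =>
    rw [hs, hs, hl, hl, CompletedYangian.smul_C_mul_X_val, ha, hm, hm]
    simp only [hgx, hlie, PowerSeries.monomial_mul_monomial]
    rw [add_comm s r, ← map_add, hX, hsmul, add_right_comm r 1 s, ← add_assoc r s 1, ← map_sub,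
      ← map_sub]
    exact fin _ (.x_x e i j r s)
  | serre e i j hij r s =>
    have hn : ∀ {m : ℕ} (y : Fin m → CompletedYangian D) (z : CompletedYangian D),
        (nest y z).1 = nest (fun k => (y k).1) z.1 :=
      fun y z => map_nest (completedSubring D).subtype y z
    have hsum : ∀ f : Equiv.Perm (Fin (1 - D.A i j).toNat) → CompletedYangian D,
        (∑ p, f p).1 = ∑ p, (f p).1 := fun f => map_sum (completedSubring D).subtype f _
    rw [hsum]
    simp only [hn, hgx, monomial_nest]
    have he : ∀ p : Equiv.Perm (Fin (1 - D.A i j).toNat), ∑ k, r (p k) = ∑ k, r k :=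
      fun p => Equiv.sum_comp p r
    simp only [he, ← map_sum]
    exact fin _ (.serre e i j hij r s)

/-- The canonical homomorphism from the Yangian to its completion. -/
noncomputable def CompletedYangian.incl : Yangian D →ₐ[ℂ[X]] CompletedYangian D :=
  Presented.lift (CompletedYangian.gen D) fun _ hb => CompletedYangian.relator_eq_zero D hb

end CompletedYangian

section KacMoody

attribute [local instance 100] LieRing.ofAssociativeRing

variable {I H : Type*} [Fintype I] [DecidableEq I] [AddCommGroup H] [Module ℂ H]
variable (D : CartanRealization I H)

/-- Symbols for the generators of the Kac--Moody algebra: `cart a` for `a ∈ 𝔥`, `ef 1 i` for `e_i`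
and `ef (-1) i` for `f_i`. -/
inductive ChevalleyGen (I H : Type*)
  | cart : H → ChevalleyGen I H
  | ef : ℤˣ → I → ChevalleyGen I H

/-- The defining relations of the symmetrizable Kac--Moody algebra: those of `𝔥` and of its action,
`[e_i, f_j] = δ_{ij} α_i^∨`, and the Serre relations `ad(e_i)^{1-a_{ij}} e_j = 0`,
`ad(f_i)^{1-a_{ij}} f_j = 0` for `i ≠ j`. -/
inductive KMRelator {L : Type*} [LieRing L] [LieAlgebra ℂ L] (g : ChevalleyGen I H → L) : L → Prop
  | cart_add (a b : H) : KMRelator g (g (.cart (a + b)) - (g (.cart a) + g (.cart b)))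
  | cart_smul (c : ℂ) (a : H) : KMRelator g (g (.cart (c • a)) - c • g (.cart a))
  | cart_cart (a b : H) : KMRelator g ⁅g (.cart a), g (.cart b)⁆
  | cart_ef (a : H) (e : ℤˣ) (i : I) :
      KMRelator g (⁅g (.cart a), g (.ef e i)⁆ - (((e : ℤ) : ℂ) * D.root i a) • g (.ef e i))
  | e_f (i j : I) :
      KMRelator g (⁅g (.ef 1 i), g (.ef (-1) j)⁆ - if i = j then g (.cart (D.coroot i)) else 0)
  | serre (e : ℤˣ) (i j : I) (hij : i ≠ j) :
      KMRelator g ((fun y => ⁅g (.ef e i), y⁆)^[(1 - D.A i j).toNat] (g (.ef e j)))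

/-- The Lie ideal generated by the relations. -/
noncomputable def kmIdeal : LieIdeal ℂ (FreeLieAlgebra ℂ (ChevalleyGen I H)) :=
  LieSubmodule.lieSpan ℂ _ {y | KMRelator D (FreeLieAlgebra.of ℂ) y}

/-- The Kac--Moody algebra `𝔤`. -/
abbrev KacMoody : Type _ := FreeLieAlgebra ℂ (ChevalleyGen I H) ⧸ kmIdeal D

/-- The generators of `𝔤`. -/
noncomputable def KacMoody.gen (y : ChevalleyGen I H) : KacMoody D :=
  LieSubmodule.Quotient.mk (FreeLieAlgebra.of ℂ y)

theorem KacMoody.relator_eq_zero {y : KacMoody D} (hy : KMRelator D (KacMoody.gen D) y) :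
    y = 0 := by
  have hmk : ∀ {y : FreeLieAlgebra ℂ (ChevalleyGen I H)}, KMRelator D (FreeLieAlgebra.of ℂ) y →
      (LieSubmodule.Quotient.mk' (kmIdeal D) y : KacMoody D) = 0 := fun hy =>
    (LieSubmodule.Quotient.mk_eq_zero' (N := kmIdeal D)).2 (LieSubmodule.subset_lieSpan hy)
  have hl : ∀ a b : FreeLieAlgebra ℂ (ChevalleyGen I H),
      LieSubmodule.Quotient.mk' (kmIdeal D) ⁅a, b⁆ =
        ⁅LieSubmodule.Quotient.mk' (kmIdeal D) a, LieSubmodule.Quotient.mk' (kmIdeal D) b⁆ :=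
    fun a b => LieSubmodule.Quotient.mk_bracket (I := kmIdeal D) a b
  have hg : ∀ y, KacMoody.gen D y =
    LieSubmodule.Quotient.mk' (kmIdeal D) (FreeLieAlgebra.of ℂ y) := fun _ => rfl
  cases hy with
  | cart_add a b => simpa only [hg, map_sub, map_add] using hmk (.cart_add a b)
  | cart_smul c a => simpa only [hg, map_sub, map_smul] using hmk (.cart_smul c a)
  | cart_cart a b => simpa only [hg, hl] using hmk (.cart_cart a b)
  | cart_ef a e i => simpa only [hg, map_sub, map_smul, hl] using hmk (.cart_ef a e i)
  | e_f i j =>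
    have := hmk (.e_f i j)
    rw [map_sub, hl, apply_ite (LieSubmodule.Quotient.mk' (kmIdeal D)), map_zero] at this
    exact this
  | serre e i j hij =>
    have := hmk (.serre e i j hij)
    have hi : ∀ n : ℕ, LieSubmodule.Quotient.mk' (kmIdeal D)
        ((fun y => ⁅FreeLieAlgebra.of ℂ (ChevalleyGen.ef (H := H) e i), y⁆)^[n]
          (FreeLieAlgebra.of ℂ (.ef e j))) =
        (fun y => ⁅KacMoody.gen D (.ef e i), y⁆)^[n] (KacMoody.gen D (.ef e j)) := by
      intro n
      induction n with
      | zero => rfl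
      | succ n ih => rw [Function.iterate_succ_apply', hl, ih, Function.iterate_succ_apply', hg]
    rw [← hi, this]

/-- The enveloping algebra `U(𝔤)`. -/
abbrev KacMoody.U : Type _ := UniversalEnvelopingAlgebra ℂ (KacMoody D)

/-- The evaluation at `t = 1` on generators: `h ↦ h`, `X_{i,r}^± ↦ x_i^±`, `H_{i,r} ↦ h_i`, where
`x_i^+ = √d_i e_i`, `x_i^- = √d_i f_i` and `h_i = d_i α_i^∨`. -/
noncomputable def evGen : Gen I H ℤ → KacMoody.U D
  | .cart a => UniversalEnvelopingAlgebra.ι ℂ (KacMoody.gen D (.cart a))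
  | .x e i _ => UniversalEnvelopingAlgebra.ι ℂ
      ((Real.sqrt (D.d i) : ℂ) • KacMoody.gen D (.ef e i))
  | .h i _ => UniversalEnvelopingAlgebra.ι ℂ (KacMoody.gen D (.cart ((D.d i : ℂ) • D.coroot i)))

/-- `U(𝔤)` as a `ℂ⟦ħ⟧`-algebra on which `ħ` acts by zero. -/
noncomputable abbrev evAlgebra : Algebra ℂ⟦X⟧ (KacMoody.U D) :=
  Algebra.compHom (KacMoody.U D) (PowerSeries.constantCoeff : ℂ⟦X⟧ →+* ℂ)

attribute [local instance] evAlgebra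

theorem evGen_relator {b : KacMoody.U D}
    (hb : Relator D (PowerSeries.X : ℂ⟦X⟧) (evGen D) b) : b = 0 := by
  have hC : ∀ (c : ℂ) (y : KacMoody.U D), algebraMap ℂ ℂ⟦X⟧ c • y = c • y := by
    intro c y
    change PowerSeries.constantCoeff (algebraMap ℂ ℂ⟦X⟧ c) • y = c • y
    simp
  have hX : ∀ (c : ℂ) (y : KacMoody.U D), (algebraMap ℂ ℂ⟦X⟧ c * PowerSeries.X) • y = 0 := by
    intro c y
    change PowerSeries.constantCoeff (algebraMap ℂ ℂ⟦X⟧ c * PowerSeries.X) • y = 0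
    simp
  have hl : ∀ a b : KacMoody D, (⁅UniversalEnvelopingAlgebra.ι ℂ a,
      UniversalEnvelopingAlgebra.ι ℂ b⁆ : KacMoody.U D) = UniversalEnvelopingAlgebra.ι ℂ ⁅a, b⁆ :=
    fun a b => (LieHom.map_lie _ a b).symm
  have hK : ∀ {y : KacMoody D}, KMRelator D (KacMoody.gen D) y → y = 0 :=
    fun hy => KacMoody.relator_eq_zero D hy
  have hadd : ∀ a b, KacMoody.gen D (.cart (a + b)) =
      KacMoody.gen D (.cart a) + KacMoody.gen D (.cart b) :=
    fun a b => sub_eq_zero.1 (hK (.cart_add a b))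
  have hsmul : ∀ (c : ℂ) a, KacMoody.gen D (.cart (c • a)) = c • KacMoody.gen D (.cart a) :=
    fun c a => sub_eq_zero.1 (hK (.cart_smul c a))
  have hcc : ∀ a b, ⁅KacMoody.gen D (.cart a), KacMoody.gen D (.cart b)⁆ = 0 :=
    fun a b => hK (.cart_cart a b)
  have hsq : ∀ i, (Real.sqrt (D.d i) : ℂ) * (Real.sqrt (D.d i) : ℂ) = (D.d i : ℂ) := by
    intro i
    rw [← Complex.ofReal_mul, Real.mul_self_sqrt (Nat.cast_nonneg _)]
    simp
  cases hb with
  | cart_add a b => simp only [evGen, hadd, map_add, sub_self]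
  | cart_smul c a => simp only [evGen, hC, hsmul, map_smul, sub_self]
  | h_zero i => simp only [evGen, sub_self]
  | h_h i j r s => simp only [evGen, hl, hcc, map_zero]
  | h_cart i r a => simp only [evGen, hl, hcc, map_zero]
  | cart_cart a b => simp only [evGen, hl, hcc, map_zero]
  | cart_x a e j s =>
    simp only [evGen, hl, hC, ← map_smul, ← map_sub, lie_smul]
    rw [smul_comm _ (Real.sqrt (D.d j) : ℂ), ← smul_sub, hK (.cart_ef a e j), smul_zero, map_zero]
  | x_x_neg i j r s =>
    simp only [evGen, hl]
    rw [smul_lie, lie_smul, sub_eq_zero.1 (hK (.e_f i j))]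
    split_ifs with hij
    · subst hij
      rw [smul_smul, hsq, hsmul, sub_self]
    · simp
  | h_x e i j r s => rw [hX]; simp only [evGen, sub_self]
  | x_x e i j r s => rw [hX]; simp only [evGen, sub_self]
  | serre e i j hij r s =>
    have hn : ∀ (m : ℕ) (a b : KacMoody D) (c c' : ℂ),
        nest (fun _ : Fin m => (UniversalEnvelopingAlgebra.ι ℂ (c • a) : KacMoody.U D))
          (UniversalEnvelopingAlgebra.ι ℂ (c' • b)) =
        UniversalEnvelopingAlgebra.ι ℂ ((c ^ m * c') • (fun y => ⁅a, y⁆)^[m] b) := by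
      intro m a b c c'
      induction m with
      | zero => simp [nest]
      | succ m ih =>
        have h1 : ∀ (y z : KacMoody.U D), nest (fun _ : Fin (m + 1) => y) z =
            ⁅y, nest (fun _ : Fin m => y) z⁆ := by
          intro y z; simp [nest, List.ofFn_succ]
        rw [h1, ih, hl, smul_lie, lie_smul, smul_smul, Function.iterate_succ_apply', pow_succ',
          mul_assoc]
    simp only [evGen, hn, hK (.serre e i j hij), smul_zero, map_zero, Finset.sum_const_zero]

/-- The evaluation homomorphism on the presented algebra, with `ħ ↦ 0`. -/
noncomputable def evPre : PreDouble D →+* KacMoody.U D :=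
  (Presented.lift (R := ℂ⟦X⟧) (evGen D) fun _ hb => evGen_relator D hb).toRingHom

theorem evPre_hbar {y : PreDouble D} (hy : y ∈ hbarIdeal D ^ 1) : evPre D y = 0 := by
  rw [Submodule.pow_one] at hy
  obtain ⟨c, rfl⟩ := Ideal.mem_span_singleton'.1 hy
  have h : evPre D (algebraMap ℂ⟦X⟧ (PreDouble D) PowerSeries.X) =
      algebraMap ℂ⟦X⟧ (KacMoody.U D) PowerSeries.X :=
    AlgHom.commutes (Presented.lift (R := ℂ⟦X⟧) (evGen D) fun _ hb => evGen_relator D hb) _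
  have h' : algebraMap ℂ⟦X⟧ (KacMoody.U D) PowerSeries.X = 0 := by
    change algebraMap ℂ (KacMoody.U D) (PowerSeries.constantCoeff PowerSeries.X) = 0
    simp
  rw [map_mul, h, h', mul_zero]

/-- The composite of the reduction modulo `ħ` of the Yangian double with the evaluation
homomorphism to `U(𝔤)` at `t = 1`. -/
noncomputable def ev : Double D →+* KacMoody.U D :=
  (Ideal.Quotient.lift (hbarIdeal D ^ 1) (evPre D) fun _ hy => evPre_hbar D hy).comp
    (adicCompletion.proj ℂ⟦X⟧ (hbarIdeal D) 1).toRingHom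

/-- The evaluation ideal `𝒥` at `t = 1`. -/
noncomputable def evIdeal : Ideal (Double D) := RingHom.ker (ev D)

instance : (evIdeal D).IsTwoSided := inferInstanceAs (RingHom.ker (ev D)).IsTwoSided

end KacMoody

section Induced

variable {I H : Type*} [Fintype I] [DecidableEq I] [AddCommGroup H] [Module ℂ H]
variable (D : CartanRealization I H)

/-- The completion `lim_n DY / 𝒥 ^ n` of the Yangian double. -/
noncomputable abbrev EvalCompletion : Subalgebra ℂ⟦X⟧ (∀ n : ℕ, Double D ⧸ evIdeal D ^ n) :=
  adicCompletion ℂ⟦X⟧ (evIdeal D)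

/-- The ideal `∏_{k ≥ n} Y_k` of the completed Yangian. -/
noncomputable def CompletedYangian.geq (n : ℕ) : Ideal (CompletedYangian D) where
  carrier := {y | ∀ k < n, CompletedYangian.comp D k y = 0}
  add_mem' := fun ha hb k hk => by rw [map_add, ha k hk, hb k hk, add_zero]
  zero_mem' := fun k _ => map_zero _
  smul_mem' := fun c x hx k hk => by
    change PowerSeries.coeff k (c.1 * x.1) = 0
    rw [PowerSeries.coeff_mul]
    refine Finset.sum_eq_zero fun p hp => ?_
    have h := Finset.HasAntidiagonal.mem_antidiagonal.1 hp
    have : PowerSeries.coeff p.2 x.1 = 0 := hx p.2 (by omega)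
    rw [this, mul_zero]

/-- `Γ = ι ∘ τ_{-1}`. -/
noncomputable def Gamma : Yangian D →ₐ[ℂ[X]] Double D := (iota D).comp (shift D (-1))

/-- `Φhat` is the inverse limit of homomorphisms `DY / 𝒥 ^ n → ∏_k Y_k / ∏_{k ≥ n} Y_k` induced by
`Φ`: if `ξ` and `x` have the same class in `DY / 𝒥 ^ n`, then `Φhat ξ` and `Φ x` agree modulo
`∏_{k ≥ n} Y_k`. In particular `Φ` maps `𝒥 ^ n` into `∏_{k ≥ n} Y_k`, and `Φhat` is determined
by `Φ`. -/
def InducesPhi (Φ : Double D →ₐ[ℂ⟦X⟧] CompletedYangian D)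
    (Φhat : EvalCompletion D →ₐ[ℂ⟦X⟧] CompletedYangian D) : Prop :=
  ∀ (n : ℕ) (ξ : EvalCompletion D) (x : Double D),
    adicCompletion.proj ℂ⟦X⟧ (evIdeal D) n ξ = Ideal.Quotient.mk (evIdeal D ^ n) x →
      Φhat ξ - Φ x ∈ CompletedYangian.geq D n

/-- `Γhat` is the inverse limit of homomorphisms `Y / ⨁_{k ≥ n} Y_k → DY / 𝒥 ^ n` induced by `Γ`:
if `η` and the image of `y ∈ Y` agree modulo `∏_{k ≥ n} Y_k`, then `Γhat η` and `Γ y` have the same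
class in `DY / 𝒥 ^ n`. In particular `Γ` maps `⨁_{k ≥ n} Y_k` into `𝒥 ^ n`, and `Γhat` is
determined by `Γ`. -/
def InducesGamma (Γ : Yangian D →ₐ[ℂ[X]] Double D)
    (Γhat : CompletedYangian D →ₐ[ℂ⟦X⟧] EvalCompletion D) : Prop :=
  ∀ (n : ℕ) (η : CompletedYangian D) (y : Yangian D),
    η - CompletedYangian.incl D y ∈ CompletedYangian.geq D n →
      adicCompletion.proj ℂ⟦X⟧ (evIdeal D) n (Γhat η) = Ideal.Quotient.mk (evIdeal D ^ n) (Γ y)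

end Induced
end YangianDouble
open YangianDouble

/-! The proof is a calculus of finite differences in the mode r. Under `Φ` the modes of a current
become the Newton series r ↦ ∑ (r choose n) x_n with x_n of degree n, so their n-th differences have
no component of degree below n. Functions from ℤ to the completed Yangian with this property form a
ring stable under translation (`newtonSubring`). Such a function is determined by its values on ℕ,
since modulo degree ≥ n Newton's formula expresses it by finitely many differences at 0. Every
defining relation is such a function of each of its modes, so it extends from ℕ to ℤ. On ℕ it holds
because the family there is the image of the Yangian generators under τ_1. This constructs `Phi`.

The second tool is the recursion X_{i,s+1} - X_{i,s} = S X_{i,s} (`sub_eq_modeStep`). It comes from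
the relation between H_{i,r} and X_{i,s} at r = 0. The operator S does not depend on s, and it is
built from products with H_{i,1} - H_{i,0} and with ħ, both of which lie in 𝒥. Hence the n-th
differences of X lie in 𝒥^n, and those of H = [X^+, X^-_0] do too. By binomial inversion Γ(x_n) is
the n-th difference of X at 0, so Γ maps degree n into 𝒥^n. In the completed Yangian the same
operator raises the degree, which forces `Φ` to be unique on negative modes.

That `Φ` maps 𝒥 into positive degree follows from `compZero_Phi`: the degree-zero component of `Φ`
is the evaluation followed by a homomorphism U(𝔤) → Y. Only the existence of that homomorphism
matters, not its injectivity.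

Finally `Φ` and `Γ` invert each other up to completion. The differences at 0 of a Newton series
return its coefficients (`Phi_Gamma`), and modulo 𝒥^n each X_r equals its Newton expansion, whose
coefficients are the Γ(x_k) (`gammaTrunc_Phi`). -/

open scoped fwdDiff

namespace YangianDouble

/-! ### Finite differences and Newton interpolation on ℤ -/

section FiniteDifferences

theorem eq_of_fwdDiff_eq {M : Type*} [AddCommGroup M] {f g : ℤ → M}
    (h : Δ_[1] f = Δ_[1] g) (h0 : f 0 = g 0) : f = g := by
  have hs : ∀ r, f (r + 1) - f r = g (r + 1) - g r := fun r => congrFun h r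
  funext r
  induction r with
  | zero => exact h0
  | succ n ih => rw [← sub_add_cancel (f (n + 1)) (f n), hs, ih, sub_add_cancel]
  | pred n ih =>
    have := hs (-n - 1)
    rw [sub_add_cancel, ih] at this
    exact sub_right_injective this

theorem fwdDiff_ring_choose (k : ℕ) (r : ℤ) :
    Ring.choose (r + 1) (k + 1) - Ring.choose r (k + 1) = Ring.choose r k := by
  rw [Ring.choose_succ_succ, add_sub_cancel_right]

/-- Newton's interpolation formula for a function on `ℤ` with vanishing `n`-th differences. -/
theorem newton_expansion {M : Type*} [AddCommGroup M] (n : ℕ) {f : ℤ → M}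
    (hf : (Δ_[1])^[n] f = 0) (r : ℤ) :
    f r = ∑ k ∈ Finset.range n, Ring.choose r k • (Δ_[1])^[k] f 0 := by
  induction n generalizing f r with
  | zero => simpa using congrFun hf r
  | succ n ih =>
    -- Both sides agree at 0, and their first differences agree by Pascal's rule and the induction
    -- hypothesis applied to the first difference of `f`.
    refine congrFun (eq_of_fwdDiff_eq (g := fun r => ∑ k ∈ Finset.range (n + 1),
      Ring.choose r k • (Δ_[1])^[k] f 0) ?_ ?_) r
    · funext r
      rw [ih (f := Δ_[1] f) hf r, fwdDiff, ← Finset.sum_sub_distrib, Finset.sum_range_succ']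
      simp only [← sub_smul, fwdDiff_ring_choose, Ring.choose_zero_right, sub_self,
        add_zero, Function.iterate_succ_apply]
    · rw [Finset.sum_eq_single 0]
      · simp
      · intro k _ hk
        rw [Ring.choose_zero_pos ℤ (Nat.pos_of_ne_zero hk), zero_smul]
      · simp

theorem fwdDiff_iter_map {M N : Type*} [AddCommGroup M] [AddCommGroup N] (φ : M →+ N) (n : ℕ)
    (f : ℤ → M) (r : ℤ) : (Δ_[1])^[n] (fun r => φ (f r)) r = φ ((Δ_[1])^[n] f r) := by
  simp [fwdDiff_iter_eq_sum_shift, map_sum, map_zsmul]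

theorem fwdDiff_iter_zero {M : Type*} [AddCommGroup M] (n : ℕ) :
    (Δ_[1])^[n] (0 : ℤ → M) = 0 := by
  funext r
  simp [fwdDiff_iter_eq_sum_shift]

theorem fwdDiff_iter_mem {M : Type*} [AddCommGroup M] (S : AddSubgroup M) {f : ℤ → M} {r : ℤ}
    {n : ℕ} (h : ∀ k ≤ n, f (r + k) ∈ S) : (Δ_[1])^[n] f r ∈ S := by
  rw [fwdDiff_iter_eq_sum_shift]
  refine S.sum_mem fun k hk => S.zsmul_mem ?_ _
  simpa using h k (Nat.lt_succ_iff.1 (Finset.mem_range.1 hk))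

/-- Modulo `S` the function is given by Newton's formula, whose coefficients, the differences at 0,
are integer combinations of values at natural numbers only. -/
theorem mem_of_fwdDiff_iter_mem {M : Type*} [AddCommGroup M] (S : AddSubgroup M) {f : ℤ → M}
    {n : ℕ} (hf : ∀ r, (Δ_[1])^[n] f r ∈ S) (h : ∀ r : ℕ, f r ∈ S) (r : ℤ) : f r ∈ S := by
  have := newton_expansion n (f := fun r => QuotientAddGroup.mk' S (f r)) (by
    funext r
    rw [fwdDiff_iter_map]
    exact (QuotientAddGroup.eq_zero_iff _).2 (hf r)) r
  refine (QuotientAddGroup.eq_zero_iff _).1 (this.trans ?_)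
  refine Finset.sum_eq_zero fun k _ => ?_
  rw [fwdDiff_iter_map, QuotientAddGroup.mk'_apply, (QuotientAddGroup.eq_zero_iff _).2, smul_zero]
  exact fwdDiff_iter_mem S fun l _ => by simpa using h l

variable {A : Type*} [Ring A] (F : ℕ → Ideal A)

/-- By the discrete Leibniz rule Δ(fg) = Δf · g(· + 1) + f · Δg. The offsets `k` and `l` let the
induction hypothesis apply to Δf and Δg, which lie one filtration step deeper. -/
theorem fwdDiff_iter_mul_mem (hmul : ∀ m n, ∀ a ∈ F m, ∀ b ∈ F n, a * b ∈ F (m + n))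
    (n k l : ℕ) {f g : ℤ → A} (hf : ∀ m r, (Δ_[1])^[m] f r ∈ F (m + k))
    (hg : ∀ m r, (Δ_[1])^[m] g r ∈ F (m + l)) (r : ℤ) :
    (Δ_[1])^[n] (f * g) r ∈ F (n + (k + l)) := by
  induction n generalizing k l f g with
  | zero => simpa using hmul _ _ _ (hf 0 r) _ (hg 0 r)
  | succ n ih =>
    have h : Δ_[1] (f * g) = Δ_[1] f * (fun r => g (r + 1)) + f * Δ_[1] g := by
      funext r
      simp only [fwdDiff, Pi.mul_apply, Pi.add_apply, sub_mul, mul_sub]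
      abel
    rw [Function.iterate_succ_apply, h, fwdDiff_iter_add]
    refine Ideal.add_mem _ ?_ ?_
    · have := ih (k + 1) l (f := Δ_[1] f) (g := fun r => g (r + 1))
        (fun m r => by simpa [add_assoc, add_comm 1 k] using hf (m + 1) r)
        (fun m r => by rw [fwdDiff_iter_comp_add]; exact hg m _)
      rwa [show n + (k + 1 + l) = n + 1 + (k + l) by ring] at this
    · have := ih k (l + 1) (f := f) (g := Δ_[1] g) hf
        (fun m r => by simpa [add_assoc, add_comm 1 l] using hg (m + 1) r)
      rwa [show n + (k + (l + 1)) = n + 1 + (k + l) by ring] at this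

/-- The functions on `ℤ` whose `n`-th differences lie in the `n`-th step of a multiplicative
filtration; they are determined by their values on `ℕ` if the filtration is separated. -/
def newtonSubring (h0 : F 0 = ⊤) (hmul : ∀ m n, ∀ a ∈ F m, ∀ b ∈ F n, a * b ∈ F (m + n)) :
    Subring (ℤ → A) where
  carrier := {f | ∀ n r, (Δ_[1])^[n] f r ∈ F n}
  mul_mem' := fun hf hg n r => fwdDiff_iter_mul_mem F hmul n 0 0 hf hg r
  one_mem' := fun n r => by
    cases n with
    | zero => rw [h0]; trivial
    | succ n =>
      have : Δ_[1] (1 : ℤ → A) = 0 := fwdDiff_const 1 1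
      rw [Function.iterate_succ_apply, this, fwdDiff_iter_zero]
      exact zero_mem _
  add_mem' := fun hf hg n r => by
    rw [fwdDiff_iter_add]; exact Ideal.add_mem _ (hf n r) (hg n r)
  zero_mem' := fun n r => by
    rw [fwdDiff_iter_zero]; exact zero_mem _
  neg_mem' := fun {f} hf n r => by
    have := fwdDiff_iter_map (-AddMonoidHom.id A) n f r
    exact this ▸ (Ideal.neg_mem_iff _).2 (hf n r)

end FiniteDifferences

variable {I H : Type*} [Fintype I] [DecidableEq I] [AddCommGroup H] [Module ℂ H]
variable (D : CartanRealization I H)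

/-! ### The degree filtration and maps out of adic completions -/

section Filtration

variable {D}

theorem CompletedYangian.ext_comp {a b : CompletedYangian D}
    (h : ∀ k, comp D k a = comp D k b) : a = b :=
  Subtype.ext (PowerSeries.ext h)

theorem CompletedYangian.comp_mk (f : ℕ → Yangian D) (hf : PowerSeries.mk f ∈ completedSubring D)
    (k : ℕ) : comp D k (⟨PowerSeries.mk f, hf⟩ : completedSubring D) = f k := by
  change PowerSeries.coeff k (PowerSeries.mk f) = f k
  exact PowerSeries.coeff_mk k f

theorem CompletedYangian.comp_mul (k : ℕ) (a b : CompletedYangian D) :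
    comp D k (a * b) =
      ∑ p ∈ Finset.HasAntidiagonal.antidiagonal k, comp D p.1 a * comp D p.2 b :=
  PowerSeries.coeff_mul k a.1 b.1

theorem CompletedYangian.mem_geq {n : ℕ} {a : CompletedYangian D} :
    a ∈ geq D n ↔ ∀ k < n, comp D k a = 0 := Iff.rfl

theorem CompletedYangian.geq_zero : geq D 0 = ⊤ := by
  ext; simp [mem_geq]

theorem CompletedYangian.mul_mem_geq (m n : ℕ) :
    ∀ a ∈ geq D m, ∀ b ∈ geq D n, a * b ∈ geq D (m + n) := by
  intro a ha b hb k hk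
  rw [comp_mul]
  refine Finset.sum_eq_zero fun p hp => ?_
  have h := Finset.HasAntidiagonal.mem_antidiagonal.1 hp
  rcases lt_or_ge p.1 m with h1 | h1
  · rw [ha _ h1, zero_mul]
  · rw [hb _ (by omega), mul_zero]

theorem CompletedYangian.eq_zero_of_mem_geq {a : CompletedYangian D} (h : ∀ n, a ∈ geq D n) :
    a = 0 :=
  ext_comp fun k => by rw [h (k + 1) k (Nat.lt_succ_self k), map_zero]

theorem CompletedYangian.eq_of_sub_mem_geq {a b : CompletedYangian D}
    (h : ∀ n, a - b ∈ geq D n) : a = b :=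
  sub_eq_zero.1 (eq_zero_of_mem_geq h)

theorem CompletedYangian.scalar_X_mem :
    algebraMap ℂ⟦X⟧ (CompletedYangian D) PowerSeries.X ∈ geq D 1 := by
  intro k hk
  obtain rfl : k = 0 := by omega
  change PowerSeries.coeff 0 (scalarSeries D PowerSeries.X) = 0
  rw [coeff_scalarSeries, PowerSeries.coeff_zero_X, zero_smul]

/-- Serves both the ideal generated by ħ and the evaluation ideal: a filtration bound on all powers
need only be checked on the ideal itself. -/
theorem CompletedYangian.map_pow_mem {A : Type*} [Ring A] (J : Ideal A)
    (φ : A →+* CompletedYangian D) (h : ∀ a ∈ J, φ a ∈ geq D 1) (n : ℕ) :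
    ∀ a ∈ J ^ n, φ a ∈ geq D n := by
  induction n with
  | zero => intro a _; rw [geq_zero]; trivial
  | succ n ih =>
    intro a ha
    rw [Submodule.pow_succ] at ha
    refine Submodule.mul_induction_on ha (fun x hx y hy => ?_) fun x y hx hy => ?_
    · rw [map_mul]
      exact mul_mem_geq n 1 _ (ih x hx) _ (h y hy)
    · rw [map_add]
      exact Ideal.add_mem _ hx hy

variable {A : Type*} [Ring A] [Algebra ℂ⟦X⟧ A] (J : Ideal A) [J.IsTwoSided]

theorem adicCompletion.proj_eq_of_le {ξ : adicCompletion ℂ⟦X⟧ J} {m n : ℕ} (h : m ≤ n) {a : A}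
    (ha : adicCompletion.proj ℂ⟦X⟧ J n ξ = Ideal.Quotient.mk (J ^ n) a) :
    adicCompletion.proj ℂ⟦X⟧ J m ξ = Ideal.Quotient.mk (J ^ m) a := by
  have := ξ.2 m n h
  change _ = adicCompletion.proj ℂ⟦X⟧ J m ξ at this
  rw [← this]
  change Ideal.Quotient.factorₐ ℂ⟦X⟧ _ (adicCompletion.proj ℂ⟦X⟧ J n ξ) = _
  rw [ha]
  rfl

/-- The map `lim_n A / J ^ n → ∏_k Y_k` induced by a map `A → ∏_k Y_k`. -/
noncomputable def completionLiftFun (φ : A →ₐ[ℂ⟦X⟧] CompletedYangian D)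
    (ξ : adicCompletion ℂ⟦X⟧ J) : CompletedYangian D :=
  -- The component of degree `k` is read off a representative modulo `J ^ (k + 1)`: changing the
  -- representative alters the image only in degrees above `k`, once `φ` respects the filtrations.
  ⟨PowerSeries.mk fun k => CompletedYangian.comp D k (φ (Function.surjInv
      (Ideal.Quotient.mk_surjective (I := J ^ (k + 1))) (adicCompletion.proj ℂ⟦X⟧ J (k + 1) ξ))),
    fun k => by rw [PowerSeries.coeff_mk]; exact (φ _).2 k⟩

/-- Since the degree filtration is separated, these congruences pin down the value. All algebra
axioms for the lift are deduced from them by passing to representatives. -/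
theorem completionLiftFun_sub_mem (φ : A →ₐ[ℂ⟦X⟧] CompletedYangian D)
    (hφ : ∀ n, ∀ a ∈ J ^ n, φ a ∈ CompletedYangian.geq D n) (n : ℕ)
    (ξ : adicCompletion ℂ⟦X⟧ J) (a : A)
    (h : adicCompletion.proj ℂ⟦X⟧ J n ξ = Ideal.Quotient.mk (J ^ n) a) :
    completionLiftFun J φ ξ - φ a ∈ CompletedYangian.geq D n := by
  intro k hk
  have h0 : CompletedYangian.comp D k (completionLiftFun J φ ξ) =
      CompletedYangian.comp D k (φ (Function.surjInv
      (Ideal.Quotient.mk_surjective (I := J ^ (k + 1))) (adicCompletion.proj ℂ⟦X⟧ J (k + 1) ξ))) :=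
    CompletedYangian.comp_mk _ _ k
  rw [map_sub, h0, ← map_sub, ← map_sub]
  refine hφ (k + 1) _ ?_ k (Nat.lt_succ_self k)
  rw [← Ideal.Quotient.eq]
  refine (Function.surjInv_eq _ _).trans ?_
  exact adicCompletion.proj_eq_of_le J hk h

/-- The homomorphism `lim_n A / J ^ n → ∏_k Y_k` induced by a homomorphism `A → ∏_k Y_k` that maps
`J ^ n` into `∏_{k ≥ n} Y_k`. -/
noncomputable def completionLift (φ : A →ₐ[ℂ⟦X⟧] CompletedYangian D)
    (hφ : ∀ n, ∀ a ∈ J ^ n, φ a ∈ CompletedYangian.geq D n) :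
    adicCompletion ℂ⟦X⟧ J →ₐ[ℂ⟦X⟧] CompletedYangian D :=
  have hs : ∀ n ξ, ∃ a, adicCompletion.proj ℂ⟦X⟧ J n ξ = Ideal.Quotient.mk (J ^ n) a := fun n ξ =>
    (Ideal.Quotient.mk_surjective (adicCompletion.proj ℂ⟦X⟧ J n ξ)).imp fun _ h => h.symm
  have hm := completionLiftFun_sub_mem J φ hφ
  have hc : ∀ c, completionLiftFun J φ (algebraMap ℂ⟦X⟧ _ c) = algebraMap ℂ⟦X⟧ _ c := fun c =>
    CompletedYangian.eq_of_sub_mem_geq fun n => by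
      have := hm n (algebraMap ℂ⟦X⟧ _ c) (algebraMap ℂ⟦X⟧ A c) (AlgHom.commutes _ c)
      rwa [AlgHom.commutes] at this
  { toFun := completionLiftFun J φ
    map_one' := by simpa using hc 1
    map_zero' := by simpa using hc 0
    map_mul' := fun ξ ζ => CompletedYangian.eq_of_sub_mem_geq fun n => by
      obtain ⟨a, ha⟩ := hs n ξ
      obtain ⟨b, hb⟩ := hs n ζ
      have hab := hm n (ξ * ζ) (a * b) (by rw [map_mul, ha, hb, map_mul])
      -- With F the lift, F(ξζ) - Fξ Fζ = (F(ξζ) - φ(ab)) - (Fξ - φa) φb - Fξ (Fζ - φb), and each of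
      -- the three terms has degree at least `n`.
      have h1 := CompletedYangian.mul_mem_geq n 0 _ (hm n ξ a ha) (φ b)
        (CompletedYangian.geq_zero (D := D) ▸ Submodule.mem_top)
      have h2 := Ideal.mul_mem_left _ (completionLiftFun J φ ξ) (hm n ζ b hb)
      have := Ideal.sub_mem _ (Ideal.sub_mem _ hab h1) h2
      rw [map_mul] at this
      convert this using 1
      noncomm_ring
    map_add' := fun ξ ζ => CompletedYangian.eq_of_sub_mem_geq fun n => by
      obtain ⟨a, ha⟩ := hs n ξ
      obtain ⟨b, hb⟩ := hs n ζ
      have hab := hm n (ξ + ζ) (a + b) (by rw [map_add, ha, hb, map_add])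
      have := Ideal.sub_mem _ hab (Ideal.add_mem _ (hm n ξ a ha) (hm n ζ b hb))
      rw [map_add] at this
      convert this using 1
      abel
    commutes' := hc }

theorem completionLift_sub_mem (φ : A →ₐ[ℂ⟦X⟧] CompletedYangian D)
    (hφ : ∀ n, ∀ a ∈ J ^ n, φ a ∈ CompletedYangian.geq D n) (n : ℕ)
    (ξ : adicCompletion ℂ⟦X⟧ J) (a : A)
    (h : adicCompletion.proj ℂ⟦X⟧ J n ξ = Ideal.Quotient.mk (J ^ n) a) :
    completionLift J φ hφ ξ - φ a ∈ CompletedYangian.geq D n :=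
  completionLiftFun_sub_mem J φ hφ n ξ a h

theorem completionLift_of (φ : A →ₐ[ℂ⟦X⟧] CompletedYangian D)
    (hφ : ∀ n, ∀ a ∈ J ^ n, φ a ∈ CompletedYangian.geq D n) (a : A) :
    completionLift J φ hφ (adicCompletion.of ℂ⟦X⟧ J a) = φ a :=
  CompletedYangian.eq_of_sub_mem_geq fun n => completionLift_sub_mem J φ hφ n _ a rfl

end Filtration

/-! ### Functions of integer modes determined by their natural modes -/

section Newton

variable {D}

/-- The functions from `ℤ` to the completed Yangian whose `n`-th differences have no components of
degree less than `n`. -/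
def IsNewton (f : ℤ → CompletedYangian D) : Prop :=
  f ∈ newtonSubring (CompletedYangian.geq D) CompletedYangian.geq_zero CompletedYangian.mul_mem_geq

namespace IsNewton

variable {f g : ℤ → CompletedYangian D}

theorem add (hf : IsNewton f) (hg : IsNewton g) : IsNewton fun r => f r + g r :=
  Subring.add_mem _ hf hg

theorem sub (hf : IsNewton f) (hg : IsNewton g) : IsNewton fun r => f r - g r :=
  Subring.sub_mem _ hf hg

theorem mul (hf : IsNewton f) (hg : IsNewton g) : IsNewton fun r => f r * g r :=
  Subring.mul_mem _ hf hg

theorem lie (hf : IsNewton f) (hg : IsNewton g) : IsNewton fun r => ⁅f r, g r⁆ :=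
  (hf.mul hg).sub (hg.mul hf)

theorem const (c : CompletedYangian D) : IsNewton fun _ => c := by
  intro n r
  cases n with
  | zero => rw [CompletedYangian.geq_zero]; trivial
  | succ n =>
    have : Δ_[1] (fun _ : ℤ => c) = 0 := fwdDiff_const 1 c
    rw [Function.iterate_succ_apply, this, fwdDiff_iter_zero]
    exact zero_mem _

theorem smul (c : ℂ⟦X⟧) (hf : IsNewton f) : IsNewton fun r => c • f r := by
  simp only [Algebra.smul_def]
  exact (const _).mul hf

theorem sum {ι : Type*} (s : Finset ι) {f : ι → ℤ → CompletedYangian D}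
    (hf : ∀ i, IsNewton (f i)) : IsNewton fun r => ∑ i ∈ s, f i r := by
  have := Subring.sum_mem (newtonSubring (CompletedYangian.geq D) CompletedYangian.geq_zero
    CompletedYangian.mul_mem_geq) (t := s) (f := f) fun i _ => hf i
  rwa [show ∑ i ∈ s, f i = fun r => ∑ i ∈ s, f i r from by ext; simp] at this

theorem comp_add (hf : IsNewton f) (m : ℤ) : IsNewton fun r => f (r + m) := fun n r => by
  rw [fwdDiff_iter_comp_add]; exact hf n _

theorem add_comp (hf : IsNewton f) (m : ℤ) : IsNewton fun r => f (m + r) := by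
  simpa only [add_comm m] using hf.comp_add m

theorem nest {m : ℕ} {f : Fin m → ℤ → CompletedYangian D} (hf : ∀ k, IsNewton (f k))
    (hg : IsNewton g) : IsNewton fun r => nest (fun k => f k r) (g r) := by
  induction m with
  | zero => simpa [YangianDouble.nest] using hg
  | succ m ih =>
    have h1 : ∀ (y : Fin (m + 1) → CompletedYangian D) (z : CompletedYangian D),
        YangianDouble.nest y z = ⁅y 0, YangianDouble.nest (fun k => y k.succ) z⁆ := by
      intro y z; simp [YangianDouble.nest, List.ofFn_succ]
    simp only [h1]
    exact (hf 0).lie (ih fun k => hf k.succ)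

/-- The extension principle behind all relations with negative modes: Newton's formula gives
vanishing modulo each degree, and the filtration is separated. -/
theorem eq_zero (hf : IsNewton f) (h : ∀ r : ℕ, f r = 0) (r : ℤ) : f r = 0 :=
  CompletedYangian.eq_zero_of_mem_geq fun n =>
    mem_of_fwdDiff_iter_mem (CompletedYangian.geq D n).toAddSubgroup (hf n)
      (fun r => by rw [h]; exact zero_mem _) r

theorem eq_zero₂ {F : ℤ → ℤ → CompletedYangian D} (h1 : ∀ s, IsNewton fun r => F r s)
    (h2 : ∀ r, IsNewton fun s => F r s) (h : ∀ r s : ℕ, F r s = 0) (r s : ℤ) : F r s = 0 :=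
  (h2 r).eq_zero (fun s => (h1 s).eq_zero (fun r => h r s) r) s

theorem eq_zero_pi {ι : Type*} [Finite ι] [DecidableEq ι] {F : (ι → ℤ) → CompletedYangian D}
    (h1 : ∀ r k, IsNewton fun a => F (Function.update r k a))
    (h : ∀ r : ι → ℕ, F (fun k => r k) = 0) (r : ι → ℤ) : F r = 0 := by
  cases nonempty_fintype ι
  -- Induction on the set `s` of coordinates that may be negative, freeing one coordinate at a time.
  suffices ∀ (s : Finset ι) (r : ι → ℤ), (∀ k ∉ s, ∃ n : ℕ, r k = n) → F r = 0 from
    this Finset.univ r fun k hk => (hk (Finset.mem_univ k)).elim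
  intro s
  induction s using Finset.induction_on with
  | empty =>
    intro r hr
    choose n hn using fun k => hr k (Finset.notMem_empty k)
    rw [funext hn]
    exact h n
  | insert k s _ ih =>
    intro r hr
    have := (h1 r k).eq_zero (fun a => ih _ fun l hl => ?_) (r k)
    · rwa [Function.update_eq_self] at this
    · rcases eq_or_ne l k with rfl | hlk
      · exact ⟨a, Function.update_self ..⟩
      · rw [Function.update_of_ne hlk]
        exact hr l (by simp [hlk, hl])

end IsNewton

theorem fwdDiff_iter_choose_smul {M : Type*} [AddCommGroup M] (n k : ℕ) (c : M) (r : ℤ) :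
    (Δ_[1])^[n] (fun r : ℤ => Ring.choose r k • c) r =
      if n ≤ k then Ring.choose r (k - n) • c else 0 := by
  induction n generalizing k with
  | zero => simp
  | succ n ih =>
    rw [Function.iterate_succ_apply]
    cases k with
    | zero =>
      have : Δ_[1] (fun r : ℤ => Ring.choose r 0 • c) = 0 := by
        funext r; simp [fwdDiff]
      rw [this, fwdDiff_iter_zero]
      simp
    | succ k =>
      have : Δ_[1] (fun r : ℤ => Ring.choose r (k + 1) • c) = fun r => Ring.choose r k • c := by
        funext r; rw [fwdDiff, ← sub_smul, fwdDiff_ring_choose]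
      rw [this, ih]
      simp

/-- The element `∑_n (r choose n) c_n` of `∏_n Y_n`. -/
noncomputable def binomialSeries (c : ℕ → Yangian D) (hc : ∀ n, c n ∈ Yangian.grade D n) (r : ℤ) :
    CompletedYangian D :=
  ⟨PowerSeries.mk fun n => Ring.choose r n • c n, fun k => by
    rw [PowerSeries.coeff_mk]; exact zsmul_mem (hc k) _⟩

variable (c : ℕ → Yangian D) (hc : ∀ n, c n ∈ Yangian.grade D n)

theorem comp_binomialSeries (r : ℤ) (n : ℕ) :
    CompletedYangian.comp D n (binomialSeries c hc r) = Ring.choose r n • c n :=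
  CompletedYangian.comp_mk _ _ n

theorem comp_fwdDiff_binomialSeries (n : ℕ) (r : ℤ) (k : ℕ) :
    CompletedYangian.comp D k ((Δ_[1])^[n] (binomialSeries c hc) r) =
      if n ≤ k then Ring.choose r (k - n) • c k else 0 := by
  rw [← fwdDiff_iter_map, ← fwdDiff_iter_choose_smul]
  simp only [comp_binomialSeries]

theorem isNewton_binomialSeries : IsNewton (binomialSeries c hc) := fun n r k hk => by
  rw [comp_fwdDiff_binomialSeries, if_neg (by omega)]

/-- At 0 the binomial coefficient (0 choose k - n) vanishes unless k = n, so the differences at 0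
recover the coefficients of the series. -/
theorem fwdDiff_binomialSeries_zero (n : ℕ) :
    (Δ_[1])^[n] (binomialSeries c hc) 0 = CompletedYangian.single D n (c n) (hc n) := by
  refine CompletedYangian.ext_comp fun k => ?_
  rw [comp_fwdDiff_binomialSeries]
  refine Eq.trans ?_ (PowerSeries.coeff_monomial k n (c n)).symm
  rcases lt_trichotomy n k with h | rfl | h
  · rw [if_pos h.le, if_neg h.ne', Ring.choose_zero_pos ℤ (by omega), zero_smul]
  · simp
  · rw [if_neg (by omega), if_neg (by omega)]

/-- The Gregory–Newton formula at a natural number. The scalars are written as in `shiftFamily` with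
shift 1, so that the right side is the value of τ_1 on a generator. -/
theorem binomialSeries_natCast (r : ℕ) :
    binomialSeries c hc r = ∑ k ∈ Finset.range (r + 1),
      ((r.choose k : ℂ[X]) * (algebraMap ℂ ℂ[X] 1) ^ (r - k)) •
        CompletedYangian.single D k (c k) (hc k) := by
  have := shift_eq_sum_fwdDiff_iter (1 : ℤ) (binomialSeries c hc) r 0
  rw [zero_add, nsmul_one] at this
  rw [this]
  refine Finset.sum_congr rfl fun k _ => ?_
  rw [map_one, one_pow, mul_one, Nat.cast_smul_eq_nsmul, fwdDiff_binomialSeries_zero]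

end Newton

/-! ### Construction of Φ -/

section Phi

/-- The family `h ↦ h`, `X_{i,r} ↦ ∑_n (r choose n) x_{i,n}`, `H_{i,r} ↦ ∑_n (r choose n) h_{i,n}`
in the completed Yangian. -/
noncomputable def binomialFamily : Gen I H ℤ → CompletedYangian D
  | .cart a => CompletedYangian.gen D (.cart a)
  | .x e i r => binomialSeries (fun n => Yangian.gen D (.x e i n)) (Yangian.x_mem D e i) r
  | .h i r => binomialSeries (fun n => Yangian.gen D (.h i n)) (Yangian.h_mem D i) r

theorem CompletedYangian.incl_gen (y : Gen I H ℕ) :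
    incl D (Yangian.gen D y) = gen D y := Presented.lift_gen _ _ y

theorem shift_gen (c : ℂ) (y : Gen I H ℕ) :
    shift D c (Yangian.gen D y) = shiftFamily (algebraMap ℂ ℂ[X] c) (Yangian.gen D) y :=
  Presented.lift_gen _ _ y

theorem binomialFamily_toInt (y : Gen I H ℕ) :
    binomialFamily D y.toInt =
      (CompletedYangian.incl D).comp (shift D 1) (Yangian.gen D y) := by
  rw [AlgHom.comp_apply, shift_gen]
  cases y with
  | cart a => exact (CompletedYangian.incl_gen D (.cart a)).symm
  | x e i r =>
    simp only [shiftFamily, map_sum, map_smul, CompletedYangian.incl_gen]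
    exact binomialSeries_natCast _ (Yangian.x_mem D e i) r
  | h i r =>
    simp only [shiftFamily, map_sum, map_smul, CompletedYangian.incl_gen]
    exact binomialSeries_natCast _ (Yangian.h_mem D i) r

/-- On natural modes the family is the image of the Yangian generators under an algebra
homomorphism, so it inherits their relations. -/
theorem binomialFamily_relator_nat {b : CompletedYangian D}
    (hb : Relator D (Polynomial.X : ℂ[X]) (fun y => binomialFamily D (Gen.toInt y)) b) :
    b = 0 := by
  simp only [binomialFamily_toInt] at hb
  obtain ⟨y, hy, rfl⟩ := (relator_map_iff _).1 hb
  rw [Presented.relator_eq_zero hy, map_zero]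

theorem isNewton_x (e : ℤˣ) (i : I) : IsNewton fun r => binomialFamily D (.x e i r) :=
  isNewton_binomialSeries _ (Yangian.x_mem D e i)

theorem isNewton_h (i : I) : IsNewton fun r => binomialFamily D (.h i r) :=
  isNewton_binomialSeries _ (Yangian.h_mem D i)

/-- With the other modes fixed, each relator is a Newton function of each mode, because it is built
from translates of Newton functions by sums, products and scalars. Vanishing on natural modes
therefore spreads to all integers, one mode at a time. -/
theorem binomialFamily_relator {b : CompletedYangian D}
    (hb : Relator D (PowerSeries.X : ℂ⟦X⟧) (binomialFamily D) b) : b = 0 := by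
  have hs : ∀ (p : ℂ[X]) (y : CompletedYangian D), (p : ℂ⟦X⟧) • y = p • y := fun _ _ => rfl
  have hc : ∀ c : ℂ, algebraMap ℂ ℂ⟦X⟧ c = ((algebraMap ℂ ℂ[X] c : ℂ[X]) : ℂ⟦X⟧) := by
    intro c; simp
  have hcX : ∀ c : ℂ, algebraMap ℂ ℂ⟦X⟧ c * PowerSeries.X =
      ((algebraMap ℂ ℂ[X] c * Polynomial.X : ℂ[X]) : ℂ⟦X⟧) := by
    intro c; simp
  have hN : ∀ {b}, Relator D (Polynomial.X : ℂ[X]) (fun y => binomialFamily D (Gen.toInt y)) b →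
      b = 0 := fun hb => binomialFamily_relator_nat D hb
  have hX := isNewton_x D
  have hH := isNewton_h D
  have hK : ∀ c : CompletedYangian D, IsNewton fun _ => c := IsNewton.const
  cases hb with
  | cart_add a b => exact hN (.cart_add a b)
  | cart_smul c a => rw [hc, hs]; exact hN (.cart_smul c a)
  | h_zero i => exact hN (.h_zero i)
  | h_h i j r s =>
    exact IsNewton.eq_zero₂ (F := fun r s => ⁅binomialFamily D (.h i r), binomialFamily D (.h j s)⁆)
      (fun s => (hH i).lie (hK _)) (fun r => (hK _).lie (hH j)) (fun r s => hN (.h_h i j r s)) r s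
  | h_cart i r a => exact ((hH i).lie (hK _)).eq_zero (fun r => hN (.h_cart i r a)) r
  | cart_cart a b => exact hN (.cart_cart a b)
  | cart_x a e j s =>
    refine (((hK _).lie (hX e j)).sub ((hX e j).smul _)).eq_zero (fun s => ?_) s
    rw [hc, hs]
    exact hN (.cart_x a e j s)
  | x_x_neg i j r s =>
    refine IsNewton.eq_zero₂ (F := fun r s => ⁅binomialFamily D (.x 1 i r),
        binomialFamily D (.x (-1) j s)⁆ - if i = j then binomialFamily D (.h i (r + s)) else 0)
      (fun s => ((hX _ _).lie (hK _)).sub ?_) (fun r => ((hK _).lie (hX _ _)).sub ?_)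
      (fun r s => ?_) r s
    · split_ifs
      exacts [(hH i).comp_add s, hK 0]
    · split_ifs
      exacts [(hH i).add_comp r, hK 0]
    · simpa [Gen.toInt] using hN (.x_x_neg i j r s)
  | h_x e i j r s =>
    refine IsNewton.eq_zero₂ (F := fun r s =>
      ⁅binomialFamily D (.h i (r + 1)), binomialFamily D (.x e j s)⁆ -
        ⁅binomialFamily D (.h i r), binomialFamily D (.x e j (s + 1))⁆ -
        (algebraMap ℂ ℂ⟦X⟧ (((e : ℤ) : ℂ) * D.dd i j) * PowerSeries.X) •
          (binomialFamily D (.h i r) * binomialFamily D (.x e j s) +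
            binomialFamily D (.x e j s) * binomialFamily D (.h i r)))
      (fun s => ((((hH i).comp_add 1).lie (hK _)).sub ((hH i).lie (hK _))).sub
        ((((hH i).mul (hK _)).add ((hK _).mul (hH i))).smul _))
      (fun r => (((hK _).lie (hX e j)).sub ((hK _).lie ((hX e j).comp_add 1))).sub
        ((((hK _).mul (hX e j)).add ((hX e j).mul (hK _))).smul _))
      (fun r s => ?_) r s
    rw [hcX, hs]
    exact hN (.h_x e i j r s)
  | x_x e i j r s =>
    refine IsNewton.eq_zero₂ (F := fun r s =>
      ⁅binomialFamily D (.x e i (r + 1)), binomialFamily D (.x e j s)⁆ -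
        ⁅binomialFamily D (.x e i r), binomialFamily D (.x e j (s + 1))⁆ -
        (algebraMap ℂ ℂ⟦X⟧ (((e : ℤ) : ℂ) * D.dd i j) * PowerSeries.X) •
          (binomialFamily D (.x e i r) * binomialFamily D (.x e j s) +
            binomialFamily D (.x e j s) * binomialFamily D (.x e i r)))
      (fun s => ((((hX e i).comp_add 1).lie (hK _)).sub ((hX e i).lie (hK _))).sub
        ((((hX e i).mul (hK _)).add ((hK _).mul (hX e i))).smul _))
      (fun r => (((hK _).lie (hX e j)).sub ((hK _).lie ((hX e j).comp_add 1))).sub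
        ((((hK _).mul (hX e j)).add ((hX e j).mul (hK _))).smul _))
      (fun r s => ?_) r s
    rw [hcX, hs]
    exact hN (.x_x e i j r s)
  | serre e i j hij r s =>
    refine IsNewton.eq_zero (f := fun s => ∑ p : Equiv.Perm (Fin (1 - D.A i j).toNat),
      nest (fun k => binomialFamily D (.x e i (r (p k)))) (binomialFamily D (.x e j s)))
      (IsNewton.sum _ fun p => IsNewton.nest (fun k => hK _) (hX e j)) (fun s => ?_) s
    refine IsNewton.eq_zero_pi (F := fun r => ∑ p : Equiv.Perm (Fin (1 - D.A i j).toNat),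
      nest (fun k => binomialFamily D (.x e i (r (p k)))) (binomialFamily D (.x e j s)))
      (fun r k => IsNewton.sum _ fun p => IsNewton.nest (fun l => ?_) (hK _))
      (fun r => hN (.serre e i j hij r s)) r
    -- When the mode with index `k` varies, only the slot `l` with `p l = k` moves and the others
    -- stay constant.
    rcases eq_or_ne (p l) k with h | h
    · simpa only [h, Function.update_self] using hX e i
    · simpa only [Function.update_of_ne h] using hK _

/-- The restriction of `Φ` to the presented algebra. -/
noncomputable def PhiPre : PreDouble D →ₐ[ℂ⟦X⟧] CompletedYangian D :=
  Presented.lift (binomialFamily D) fun _ hb => binomialFamily_relator D hb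

theorem PhiPre_mem (n : ℕ) : ∀ a ∈ hbarIdeal D ^ n, PhiPre D a ∈ CompletedYangian.geq D n := by
  refine CompletedYangian.map_pow_mem (hbarIdeal D) (PhiPre D).toRingHom (fun a ha => ?_) n
  obtain ⟨c, rfl⟩ := Ideal.mem_span_singleton'.1 ha
  rw [map_mul]
  refine Ideal.mul_mem_left _ _ ?_
  have := (PhiPre D).commutes PowerSeries.X
  exact this ▸ CompletedYangian.scalar_X_mem

/-- The homomorphism `Φ` from the Yangian double to the completed Yangian. -/
noncomputable def Phi : Double D →ₐ[ℂ⟦X⟧] CompletedYangian D :=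
  completionLift (hbarIdeal D) (PhiPre D) (PhiPre_mem D)

theorem Phi_of (a : PreDouble D) : Phi D (Double.of D a) = PhiPre D a :=
  completionLift_of (hbarIdeal D) (PhiPre D) (PhiPre_mem D) a

theorem Phi_gen (y : Gen I H ℤ) : Phi D (Double.gen D y) = binomialFamily D y :=
  (Phi_of D _).trans (Presented.lift_gen _ _ y)

theorem iota_gen (y : Gen I H ℕ) : iota D (Yangian.gen D y) = Double.gen D y.toInt :=
  Presented.lift_gen _ _ y

/-- Ring homomorphisms from a presented algebra that agree on scalars and generators are equal. -/
theorem Presented.ringHom_ext {R : Type*} [CommRing R] [Algebra ℂ R] {hbar : R} {K : Type*}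
    [AddMonoidWithOne K] {B : Type*} [Semiring B] {φ ψ : Presented D hbar K →+* B}
    (h0 : ∀ r, φ (algebraMap R _ r) = ψ (algebraMap R _ r))
    (h : ∀ y, φ (Presented.gen D hbar K y) = ψ (Presented.gen D hbar K y)) (a) : φ a = ψ a := by
  obtain ⟨a, rfl⟩ := RingQuot.mkAlgHom_surjective R (fun a b : FreeAlgebra R (Gen I H K) =>
    Relator D hbar (FreeAlgebra.ι R) a ∧ b = 0) a
  induction a using FreeAlgebra.induction with
  | grade0 r =>
    have : RingQuot.mkAlgHom R (fun a b : FreeAlgebra R (Gen I H K) =>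
        Relator D hbar (FreeAlgebra.ι R) a ∧ b = 0) (algebraMap R _ r) =
        algebraMap R (Presented D hbar K) r := AlgHom.commutes _ r
    rw [this]; exact h0 r
  | grade1 y => exact h y
  | mul a b ha hb =>
    rw [map_mul]
    exact (map_mul φ _ _).trans ((congrArg₂ _ ha hb).trans (map_mul ψ _ _).symm)
  | add a b ha hb =>
    rw [map_add]
    exact (map_add φ _ _).trans ((congrArg₂ _ ha hb).trans (map_add ψ _ _).symm)

theorem Phi_iota (y : Yangian D) : Phi D (iota D y) = CompletedYangian.incl D (shift D 1 y) := by
  refine Presented.ringHom_ext D (φ := (Phi D).toRingHom.comp (iota D).toRingHom)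
    (ψ := ((CompletedYangian.incl D).comp (shift D 1)).toRingHom) (fun p => ?_) (fun y => ?_) y
  · have h1 : iota D (algebraMap ℂ[X] _ p) = algebraMap ℂ⟦X⟧ (Double D) (p : ℂ⟦X⟧) :=
      (iota D).commutes p
    have h2 := ((CompletedYangian.incl D).comp (shift D 1)).commutes p
    refine (congrArg (Phi D) h1).trans (((Phi D).commutes _).trans h2.symm)
  · exact (congrArg (Phi D) (iota_gen D y)).trans ((Phi_gen D _).trans (binomialFamily_toInt D y))

end Phi

/-! ### Density of the presented algebra in its ħ-adic completion -/

section Density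

theorem mem_span_algebraMap_pow {R A : Type*} [CommRing R] [Ring A] [Algebra R A] {r : R} {n : ℕ}
    {a : A} : a ∈ Ideal.span {algebraMap R A r} ^ n ↔ ∃ c : A, r ^ n • c = a := by
  rw [Ideal.span_singleton_pow, Ideal.mem_span_singleton']
  simp only [Algebra.smul_def, map_pow]
  exact exists_congr fun c => by rw [← map_pow, Algebra.commutes]

/-- For representatives a_m of `x` one has a_{m+1} - a_m = r^m c_m, so x - a_n is the sum of r^m c_m
over m ≥ n. Factoring out r^n leaves a convergent series; no torsion-freeness is needed because the
c_m are chosen first. -/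
theorem adicCompletion.exists_of_add {R A : Type*} [CommRing R] [Ring A] [Algebra R A] (r : R)
    (x : adicCompletion R (Ideal.span {algebraMap R A r})) (n : ℕ) :
    ∃ (a : A) (x' : adicCompletion R (Ideal.span {algebraMap R A r})),
      x = adicCompletion.of R _ a + r ^ n • x' := by
  set J := Ideal.span {algebraMap R A r}
  choose a ha using fun m => Ideal.Quotient.mk_surjective (x.1 m)
  have hx : ∀ {l m}, l ≤ m → Ideal.Quotient.mk (J ^ l) (a m) = x.1 l := fun {l m} h => by
    rw [← x.2 l m h, ← ha m]; rfl
  have hd : ∀ m, ∃ c : A, r ^ m • c = a (m + 1) - a m := fun m =>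
    mem_span_algebraMap_pow.1 (Ideal.Quotient.eq.1 ((hx m.le_succ).trans (ha m).symm))
  choose c hc using hd
  have hs : ∀ m, r ^ n • ∑ j ∈ Finset.range m, r ^ j • c (n + j) = a (n + m) - a n := by
    intro m
    simp only [Finset.smul_sum, smul_smul, ← pow_add, hc]
    exact Finset.sum_range_sub (fun j => a (n + j)) m
  refine ⟨a n, ⟨fun l => Ideal.Quotient.mk (J ^ l) (∑ j ∈ Finset.range l, r ^ j • c (n + j)),
    fun l m h => ?_⟩, Subtype.ext (funext fun l => ?_)⟩
  · refine Ideal.Quotient.eq.2 ?_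
    rw [← Finset.sum_range_add_sum_Ico _ h, add_sub_cancel_left]
    refine sum_mem fun j hj => mem_span_algebraMap_pow.2 ⟨r ^ (j - l) • c (n + j), ?_⟩
    rw [smul_smul, ← pow_add, Nat.add_sub_cancel' (Finset.mem_Ico.1 hj).1]
  -- The representative a_{n+l} of `x` modulo `J ^ l` is the one that the telescoping sum of length
  -- `l` reaches from a_n.
  · rw [← hx (Nat.le_add_left l n)]
    change _ = Ideal.Quotient.mk (J ^ l) (a n) +
      Ideal.Quotient.mk (J ^ l) (r ^ n • ∑ j ∈ Finset.range l, r ^ j • c (n + j))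
    rw [hs, ← map_add, add_sub_cancel]

/-- Every element of the Yangian double is congruent to one of the presented algebra modulo the
multiples of `ħ ^ n`. -/
theorem Double.exists_of_add (x : Double D) (n : ℕ) :
    ∃ (a : PreDouble D) (x' : Double D),
      x = Double.of D a + (PowerSeries.X : ℂ⟦X⟧) ^ n • x' :=
  adicCompletion.exists_of_add _ x n

end Density

/-! ### The recursion in the mode -/

section Recursion

variable {D} {B : Type*} [Ring B] [Algebra ℂ⟦X⟧ B] (g : Gen I H ℤ → B)

variable (D) in
/-- The operator that maps `X_{i,s}^±` to `X_{i,s+1}^± - X_{i,s}^±`. -/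
noncomputable def modeStep (e : ℤˣ) (i : I) : B →+ B where
  -- The inverted scalar ±2d_i is the eigenvalue of the commutator with h_{i,0} on the modes of
  -- x_i^±.
  toFun y := algebraMap ℂ ℂ⟦X⟧ (((e : ℤ) : ℂ) * (2 * D.d i))⁻¹ •
    (⁅g (.h i 1) - g (.h i 0), y⁆ - (algebraMap ℂ ℂ⟦X⟧ (((e : ℤ) : ℂ) * D.d i) * PowerSeries.X) •
      (g (.h i 0) * y + y * g (.h i 0)))
  map_zero' := by simp [Ring.lie_def]
  map_add' y z := by
    rw [← smul_add]
    congr 1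
    simp only [Ring.lie_def, mul_add, add_mul, smul_add]
    abel

/-- Take i = j and r = 0 in the relation between h and x. Since h_{i,0} = d_i α_i^∨ acts on every
x_{i,s} by ±2d_i ≠ 0, the bracket with x_{i,s+1} becomes a multiple of x_{i,s+1}. Subtracting
[h_{i,0}, x_{i,s}] then isolates the difference. -/
theorem sub_eq_modeStep (hg : ∀ b, Relator D (PowerSeries.X : ℂ⟦X⟧) g b → b = 0)
    (e : ℤˣ) (i : I) (s : ℤ) :
    g (.x e i (s + 1)) - g (.x e i s) = modeStep D g e i (g (.x e i s)) := by
  have hd : D.dd i i = D.d i := by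
    rw [CartanRealization.dd, D.diag]; push_cast; ring
  have hr : D.root i ((D.d i : ℂ) • D.coroot i) = 2 * D.d i := by
    rw [map_smul, D.pairing, D.diag, smul_eq_mul]; push_cast; ring
  have h0 : ∀ s, ⁅g (.h i 0), g (.x e i s)⁆ =
      algebraMap ℂ ℂ⟦X⟧ (((e : ℤ) : ℂ) * (2 * D.d i)) • g (.x e i s) := by
    intro s
    rw [sub_eq_zero.1 (hg _ (.h_zero i)),
      sub_eq_zero.1 (hg _ (.cart_x ((D.d i : ℂ) • D.coroot i) e i s)), hr]
  have h1 := hg _ (.h_x e i i 0 s)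
  rw [h0, hd, zero_add] at h1
  have hu : ((e : ℤ) : ℂ) * (2 * D.d i) ≠ 0 := by
    have := (D.d_pos i).ne'
    rcases Int.units_eq_one_or e with rfl | rfl <;> simpa
  have h2 : algebraMap ℂ ℂ⟦X⟧ (((e : ℤ) : ℂ) * (2 * D.d i)) •
      (g (.x e i (s + 1)) - g (.x e i s)) =
      ⁅g (.h i 1) - g (.h i 0), g (.x e i s)⁆ -
        (algebraMap ℂ ℂ⟦X⟧ (((e : ℤ) : ℂ) * D.d i) * PowerSeries.X) •
          (g (.h i 0) * g (.x e i s) + g (.x e i s) * g (.h i 0)) := by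
    have h3 : ⁅g (.h i 1) - g (.h i 0), g (.x e i s)⁆ =
        ⁅g (.h i 1), g (.x e i s)⁆ - ⁅g (.h i 0), g (.x e i s)⁆ := by
      simp only [Ring.lie_def, sub_mul, mul_sub]; abel
    rw [h3, h0, smul_sub, ← sub_eq_zero, ← neg_eq_zero, ← h1]
    abel
  refine Eq.trans ?_ (congrArg (algebraMap ℂ ℂ⟦X⟧ (((e : ℤ) : ℂ) * (2 * D.d i))⁻¹ • ·) h2)
  rw [smul_smul, ← map_mul, inv_mul_cancel₀ hu, map_one, one_smul]

/-- For `y` in one step of a filtration, `K` will be the next step: both listed elements lie in the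
first step, so the operator moves `y` one step deeper. -/
theorem modeStep_mem {K : Ideal B} [K.IsTwoSided] {e : ℤˣ} {i : I} {y : B}
    (h1 : ∀ a, (a = g (.h i 1) - g (.h i 0) ∨ a = algebraMap ℂ⟦X⟧ B PowerSeries.X) →
      a * y ∈ K ∧ y * a ∈ K) :
    modeStep D g e i y ∈ K := by
  have hsmul : ∀ (c : ℂ⟦X⟧) {b : B}, b ∈ K → c • b ∈ K := fun c b hb => by
    rw [Algebra.smul_def]; exact K.mul_mem_left _ hb
  obtain ⟨h2, h3⟩ := h1 _ (.inl rfl)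
  obtain ⟨h4, h5⟩ := h1 _ (.inr rfl)
  refine hsmul _ (K.sub_mem (K.sub_mem h2 h3) ?_)
  rw [mul_smul, smul_add]
  refine hsmul _ (K.add_mem ?_ ?_)
  · rw [← mul_smul_comm, Algebra.smul_def]
    exact K.mul_mem_left _ h4
  · rw [← smul_mul_assoc, Algebra.smul_def]
    exact K.mul_mem_right _ h4

/-- The operator is additive and independent of the mode, so it commutes with differences. -/
theorem fwdDiff_iter_x_succ (hg : ∀ b, Relator D (PowerSeries.X : ℂ⟦X⟧) g b → b = 0)
    (e : ℤˣ) (i : I) (n : ℕ) (s : ℤ) :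
    (Δ_[1])^[n + 1] (fun s => g (.x e i s)) s =
      modeStep D g e i ((Δ_[1])^[n] (fun s => g (.x e i s)) s) := by
  have : Δ_[1] (fun s : ℤ => g (.x e i s)) = fun s => modeStep D g e i (g (.x e i s)) :=
    funext (sub_eq_modeStep g hg e i)
  rw [Function.iterate_succ_apply, this, fwdDiff_iter_map]

theorem h_eq_lie (hg : ∀ b, Relator D (PowerSeries.X : ℂ⟦X⟧) g b → b = 0) (i : I) (r : ℤ) :
    g (.h i r) = ⁅g (.x 1 i r), g (.x (-1) i 0)⁆ := by
  have := sub_eq_zero.1 (hg _ (.x_x_neg i i r 0))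
  rw [this, if_pos rfl, add_zero]

end Recursion

/-! ### Differences of modes in powers of the evaluation ideal -/

section EvaluationIdeal

attribute [local instance] evAlgebra

theorem ev_gen (y : Gen I H ℤ) : ev D (Double.gen D y) = evGen D y :=
  Presented.lift_gen (R := ℂ⟦X⟧) (evGen D) (fun _ hb => evGen_relator D hb) y

theorem ev_algebraMap (f : ℂ⟦X⟧) : ev D (algebraMap ℂ⟦X⟧ (Double D) f) =
    algebraMap ℂ (KacMoody.U D) (PowerSeries.constantCoeff f) :=
  AlgHom.commutes (Presented.lift (R := ℂ⟦X⟧) (evGen D) fun _ hb => evGen_relator D hb) f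

end EvaluationIdeal

section EvaluationIdeal

theorem mem_evIdeal {x : Double D} : x ∈ evIdeal D ↔ ev D x = 0 := RingHom.mem_ker

theorem hbar_mem_evIdeal : algebraMap ℂ⟦X⟧ (Double D) PowerSeries.X ∈ evIdeal D := by
  rw [mem_evIdeal, ev_algebraMap, PowerSeries.constantCoeff_X, map_zero]

theorem hbar_pow_smul_mem_evIdeal (n : ℕ) (x : Double D) :
    (PowerSeries.X : ℂ⟦X⟧) ^ n • x ∈ evIdeal D ^ n := by
  rw [Algebra.smul_def, map_pow]
  exact Ideal.mul_mem_right _ _ (Ideal.pow_mem_pow (hbar_mem_evIdeal D) n)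

theorem h_sub_h_mem_evIdeal (i : I) (r s : ℤ) :
    Double.gen D (.h i r) - Double.gen D (.h i s) ∈ evIdeal D := by
  rw [mem_evIdeal, map_sub, ev_gen, ev_gen]
  exact sub_self _

/-- Each difference is one application of `modeStep`, which contributes a factor H_{i,1} - H_{i,0}
or ħ. Both are killed by the evaluation at t = 1. -/
theorem fwdDiff_iter_x_mem (e : ℤˣ) (i : I) (n : ℕ) (s : ℤ) :
    (Δ_[1])^[n] (fun s => Double.gen D (.x e i s)) s ∈ evIdeal D ^ n := by
  induction n with
  | zero => rw [Submodule.pow_zero, Ideal.one_eq_top]; trivial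
  | succ n ih =>
    rw [fwdDiff_iter_x_succ _ fun _ hb => Double.relator_eq_zero D hb]
    refine modeStep_mem _ fun a ha => ?_
    have ha' : a ∈ evIdeal D := by
      rcases ha with rfl | rfl
      exacts [h_sub_h_mem_evIdeal D i 1 0, hbar_mem_evIdeal D]
    constructor
    · rw [Ideal.IsTwoSided.pow_succ]
      exact Ideal.mul_mem_mul ha' ih
    · rw [Submodule.pow_succ]
      exact Ideal.mul_mem_mul ih ha'

/-- Reduces to the previous case: H_{i,s} = [X^+_{i,s}, X^-_{i,0}], and bracketing with a fixed
element commutes with differences. -/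
theorem fwdDiff_iter_h_mem (i : I) (n : ℕ) (s : ℤ) :
    (Δ_[1])^[n] (fun s => Double.gen D (.h i s)) s ∈ evIdeal D ^ n := by
  simp only [h_eq_lie (Double.gen D) fun _ hb => Double.relator_eq_zero D hb]
  have := fwdDiff_iter_map
    ((commutatorMap ℤ (Double D)).flip (Double.gen D (.x (-1) i 0))).toAddMonoidHom n
    (fun s => Double.gen D (.x 1 i s)) s
  refine this ▸ Ideal.sub_mem _ (Ideal.mul_mem_right _ _ ?_) (Ideal.mul_mem_left _ _ ?_) <;>
    exact fwdDiff_iter_x_mem D 1 i n s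

end EvaluationIdeal

/-! ### Uniqueness of Φ -/

section Uniqueness

/-- Continuity is automatic: linearity over ℂ⟦ħ⟧ sends multiples of ħ^n into degree at least n, and
the target is separated. -/
theorem Double.algHom_ext {Φ Φ' : Double D →ₐ[ℂ⟦X⟧] CompletedYangian D}
    (h : ∀ y, Φ (Double.gen D y) = Φ' (Double.gen D y)) : Φ = Φ' := by
  have hpre : ∀ a : PreDouble D, Φ (Double.of D a) = Φ' (Double.of D a) := fun a =>
    Presented.ringHom_ext D (φ := (Φ.comp (Double.of D)).toRingHom)
      (ψ := (Φ'.comp (Double.of D)).toRingHom)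
      (fun r => ((Φ.comp (Double.of D)).commutes r).trans ((Φ'.comp (Double.of D)).commutes r).symm)
      h a
  ext x
  refine CompletedYangian.eq_of_sub_mem_geq fun n => ?_
  obtain ⟨a, x', rfl⟩ := Double.exists_of_add D x n
  rw [map_add, map_add, hpre, map_smul, map_smul, add_sub_add_left_eq_sub, ← smul_sub,
    Algebra.smul_def, map_pow]
  have : ∀ n, algebraMap ℂ⟦X⟧ (CompletedYangian D) PowerSeries.X ^ n ∈
      CompletedYangian.geq D n := by
    intro n
    induction n with
    | zero => rw [CompletedYangian.geq_zero]; trivial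
    | succ n ih =>
      rw [pow_succ]
      exact CompletedYangian.mul_mem_geq n 1 _ ih _ CompletedYangian.scalar_X_mem
  exact CompletedYangian.mul_mem_geq n 0 _ (this n) _
    (CompletedYangian.geq_zero (D := D) ▸ Submodule.mem_top)

theorem map_double_relator {Φ : Double D →ₐ[ℂ⟦X⟧] CompletedYangian D} (b : CompletedYangian D)
    (hb : Relator D (PowerSeries.X : ℂ⟦X⟧) (fun y => Φ (Double.gen D y)) b) : b = 0 := by
  obtain ⟨y, hy, rfl⟩ := (relator_map_iff _).1 hb
  rw [Double.relator_eq_zero D hy, map_zero]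

instance (n : ℕ) : (CompletedYangian.geq D n).IsTwoSided := ⟨fun b ha =>
  CompletedYangian.mul_mem_geq n 0 _ ha b (CompletedYangian.geq_zero (D := D) ▸ Submodule.mem_top)⟩

/-- Agreement on natural modes propagates downwards. The discrepancy δ_s on X_{i,s} satisfies
δ_{s+1} - δ_s = S δ_s with S raising the degree, so δ_{s+1} = 0 forces δ_s = 0. The modes of H are
then commutators of modes of X. -/
theorem eq_Phi {Φ : Double D →ₐ[ℂ⟦X⟧] CompletedYangian D}
    (h : ∀ y : Yangian D, Φ (iota D y) = CompletedYangian.incl D (shift D 1 y)) : Φ = Phi D := by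
  have hnat : ∀ y : Gen I H ℕ, Φ (Double.gen D y.toInt) = Phi D (Double.gen D y.toInt) := by
    intro y
    rw [← iota_gen, h, Phi_iota]
  have hrel : ∀ b, Relator D (PowerSeries.X : ℂ⟦X⟧) (fun y => Φ (Double.gen D y)) b → b = 0 :=
    fun b => map_double_relator D b
  have hrel' : ∀ b, Relator D (PowerSeries.X : ℂ⟦X⟧) (fun y => Phi D (Double.gen D y)) b → b = 0 :=
    fun b => map_double_relator D b
  have hx : ∀ e i s, Φ (Double.gen D (.x e i s)) = Phi D (Double.gen D (.x e i s)) := by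
    intro e i s
    -- The operator involves only the modes 0 and 1 of h, on which both maps already agree.
    have hS : modeStep D (fun y => Φ (Double.gen D y)) e i =
        modeStep D (fun y => Phi D (Double.gen D y)) e i := by
      have h0 := hnat (.h i 0)
      have h1 := hnat (.h i 1)
      simp only [Gen.toInt, Nat.cast_zero, Nat.cast_one] at h0 h1
      simp only [modeStep, h0, h1]
    have hstep : ∀ s, (Φ (Double.gen D (.x e i (s + 1))) - Phi D (Double.gen D (.x e i (s + 1)))) -
        (Φ (Double.gen D (.x e i s)) - Phi D (Double.gen D (.x e i s))) =
        modeStep D (fun y => Phi D (Double.gen D y)) e i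
          (Φ (Double.gen D (.x e i s)) - Phi D (Double.gen D (.x e i s))) := by
      intro s
      rw [map_sub, ← sub_eq_modeStep _ hrel' e i s, ← hS, ← sub_eq_modeStep _ hrel e i s]
      abel
    have hmem : ∀ n, ∀ z ∈ CompletedYangian.geq D n,
        modeStep D (fun y => Phi D (Double.gen D y)) e i z ∈ CompletedYangian.geq D (n + 1) := by
      intro n z hz
      refine modeStep_mem _ fun a ha => ?_
      have ha' : a ∈ CompletedYangian.geq D 1 := by
        rcases ha with rfl | rfl
        -- The degree-zero component of the image of H_{i,r} is h_{i,0} for every r, so it cancels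
        -- in the difference.
        · intro k hk
          obtain rfl : k = 0 := by omega
          simp [Phi_gen, binomialFamily, comp_binomialSeries]
        · exact CompletedYangian.scalar_X_mem
      exact ⟨add_comm 1 n ▸ CompletedYangian.mul_mem_geq 1 n a ha' z hz,
        CompletedYangian.mul_mem_geq n 1 z hz a ha'⟩
    induction s with
    | zero => exact hnat (.x e i 0)
    | succ n => exact hnat (.x e i (n + 1))
    | pred n ih =>
      have h1 := hstep (-n - 1)
      -- Now -δ = S δ, so membership of δ in degree ≥ m improves to degree ≥ m + 1, for every m.
      rw [sub_add_cancel, ih, sub_self, zero_sub] at h1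
      refine CompletedYangian.eq_of_sub_mem_geq fun m => ?_
      induction m with
      | zero => rw [CompletedYangian.geq_zero]; trivial
      | succ m hm =>
        rw [← neg_mem_iff, h1]
        exact hmem m _ hm
  refine Double.algHom_ext D fun y => ?_
  cases y with
  | cart a => exact hnat (.cart a)
  | x e i r => exact hx e i r
  | h i r =>
    rw [h_eq_lie _ hrel i r, h_eq_lie _ hrel' i r, hx, hx]

end Uniqueness

/-! ### The degree-zero component of Φ and the evaluation homomorphism -/

section EvaluationFiltration

attribute [local instance 100] LieRing.ofAssociativeRing

/-- The images of the Chevalley generators in the degree-zero part of the Yangian. -/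
noncomputable def chevalleyFamily : ChevalleyGen I H → Yangian D
  | .cart a => Yangian.gen D (.cart a)
  | .ef e i => (Real.sqrt (D.d i) : ℂ)⁻¹ • Yangian.gen D (.x e i 0)

theorem sqrt_d_ne_zero (i : I) : (Real.sqrt (D.d i) : ℂ) ≠ 0 := by
  have := D.d_pos i
  exact_mod_cast (Real.sqrt_pos.2 (by exact_mod_cast this)).ne'

theorem nest_smul_const {B : Type*} [Ring B] [Algebra ℂ B] (m : ℕ) (a b : B) (c c' : ℂ) :
    (fun y => ⁅c • a, y⁆)^[m] (c' • b) = (c ^ m * c') • nest (fun _ : Fin m => a) b := by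
  induction m with
  | zero => simp [nest]
  | succ m ih =>
    have h1 : nest (fun _ : Fin (m + 1) => a) b = ⁅a, nest (fun _ : Fin m => a) b⁆ := by
      simp [nest, List.ofFn_succ]
    rw [Function.iterate_succ_apply', ih, h1, smul_lie, lie_smul, smul_smul, pow_succ',
      mul_assoc]

/-- At mode 0 the Yangian relations without ħ specialize to those of 𝔤; the factors 1/√d_i turn
[x_i^+, x_i^-] = d_i α_i^∨ into [e_i, f_i] = α_i^∨. -/
theorem chevalleyFamily_relator {b : Yangian D} (hb : KMRelator D (chevalleyFamily D) b) :
    b = 0 := by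
  have hY : ∀ {b : Yangian D}, Relator D (Polynomial.X : ℂ[X]) (Yangian.gen D) b → b = 0 :=
    fun hb => Presented.relator_eq_zero hb
  have hC : ∀ (c : ℂ) (y : Yangian D), algebraMap ℂ ℂ[X] c • y = c • y := fun c y =>
    algebraMap_smul ℂ[X] c y
  have hsq : ∀ i, (Real.sqrt (D.d i) : ℂ)⁻¹ * (Real.sqrt (D.d i) : ℂ)⁻¹ = (D.d i : ℂ)⁻¹ := by
    intro i
    rw [← mul_inv, ← Complex.ofReal_mul, Real.mul_self_sqrt (Nat.cast_nonneg _)]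
    simp
  cases hb with
  | cart_add a b => exact hY (.cart_add a b)
  | cart_smul c a =>
    have := hY (.cart_smul c a)
    rwa [hC] at this
  | cart_cart a b => exact hY (.cart_cart a b)
  | cart_ef a e i =>
    have := hY (.cart_x a e i 0)
    rw [hC] at this
    simp only [chevalleyFamily]
    rw [lie_smul, smul_comm, ← smul_sub, this, smul_zero]
  | e_f i j =>
    have := sub_eq_zero.1 (hY (.x_x_neg i j 0 0))
    simp only [chevalleyFamily]
    rw [smul_lie, lie_smul, this, smul_smul]
    split_ifs with hij
    · subst hij
      rw [add_zero, sub_eq_zero.1 (hY (.h_zero i)), sub_eq_zero.1 (hY (.cart_smul _ _)), hC,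
        smul_smul, hsq, inv_mul_cancel₀ (by exact_mod_cast (D.d_pos i).ne'), one_smul, sub_self]
    · simp
  | serre e i j hij =>
    have := hY (.serre e i j hij (fun _ => 0) 0)
    -- With all modes equal, the m! permutations contribute the same nested commutator, and m! is
    -- invertible in ℂ.
    rw [Finset.sum_const, ← Nat.cast_smul_eq_nsmul ℂ, smul_eq_zero_iff_right (by
      simp [Fintype.card_ne_zero])] at this
    simp only [chevalleyFamily]
    rw [nest_smul_const, this, smul_zero]

/-- The homomorphism from the free Lie algebra that annihilates the relations of `𝔤`. -/
noncomputable def freeToYangian : FreeLieAlgebra ℂ (ChevalleyGen I H) →ₗ⁅ℂ⁆ Yangian D :=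
  FreeLieAlgebra.lift ℂ (chevalleyFamily D)

theorem freeToYangian_relator {y : FreeLieAlgebra ℂ (ChevalleyGen I H)}
    (hy : KMRelator D (FreeLieAlgebra.of ℂ) y) : freeToYangian D y = 0 := by
  have hg : ∀ y, freeToYangian D (FreeLieAlgebra.of ℂ y) = chevalleyFamily D y :=
    fun y => FreeLieAlgebra.lift_of_apply _ y
  refine chevalleyFamily_relator D ?_
  cases hy with
  | cart_add a b => simpa only [map_sub, map_add, hg] using KMRelator.cart_add a b
  | cart_smul c a => simpa only [map_sub, map_smul, hg] using KMRelator.cart_smul c a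
  | cart_cart a b => simpa only [LieHom.map_lie, hg] using KMRelator.cart_cart a b
  | cart_ef a e i =>
    simpa only [map_sub, map_smul, LieHom.map_lie, hg] using KMRelator.cart_ef a e i
  | e_f i j =>
    rw [map_sub, LieHom.map_lie, apply_ite (freeToYangian D), map_zero, hg, hg, hg]
    exact .e_f i j
  | serre e i j hij =>
    have hi : ∀ n : ℕ, freeToYangian D
        ((fun y => ⁅FreeLieAlgebra.of ℂ (ChevalleyGen.ef (H := H) e i), y⁆)^[n]
          (FreeLieAlgebra.of ℂ (.ef e j))) =
        (fun y => ⁅chevalleyFamily D (.ef e i), y⁆)^[n] (chevalleyFamily D (.ef e j)) := by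
      intro n
      induction n with
      | zero => exact hg _
      | succ n ih =>
        rw [Function.iterate_succ_apply', LieHom.map_lie, ih, Function.iterate_succ_apply', hg]
    rw [hi]
    exact .serre e i j hij

/-- The homomorphism from `𝔤` to the Yangian. -/
noncomputable def kacMoodyToYangian : KacMoody D →ₗ⁅ℂ⁆ Yangian D where
  toLinearMap := (kmIdeal D).toSubmodule.liftQ (freeToYangian D : _ →ₗ[ℂ] Yangian D) (by
    have : kmIdeal D ≤ (freeToYangian D).ker :=
      LieSubmodule.lieSpan_le.2 fun y hy => freeToYangian_relator D hy
    exact this)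
  map_lie' := by
    rintro ⟨a⟩ ⟨b⟩
    exact (freeToYangian D).map_lie a b

/-- The homomorphism from `U(𝔤)` to the Yangian. -/
noncomputable def enveloping : KacMoody.U D →ₐ[ℂ] Yangian D :=
  UniversalEnvelopingAlgebra.lift ℂ (kacMoodyToYangian D)

theorem enveloping_gen (y : ChevalleyGen I H) :
    enveloping D (UniversalEnvelopingAlgebra.ι ℂ (KacMoody.gen D y)) = chevalleyFamily D y :=
  (UniversalEnvelopingAlgebra.lift_ι_apply ℂ _ _).trans (FreeLieAlgebra.lift_of_apply _ _)

/-- The projection of the completed Yangian to the component of degree zero. -/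
noncomputable def compZero : CompletedYangian D →+* Yangian D where
  __ := CompletedYangian.comp D 0
  map_one' := PowerSeries.coeff_zero_one
  map_mul' a b := by
    change CompletedYangian.comp D 0 (a * b) = CompletedYangian.comp D 0 a * _
    rw [CompletedYangian.comp_mul]
    simp

/-- Both sides kill ħ, so it is enough to compare generators. Since (r choose 0) = 1, the
degree-zero component of the image of X_{i,r} is x_{i,0} whatever r is, just as the evaluation at t
= 1 forgets r. -/
theorem compZero_Phi (x : Double D) : compZero D (Phi D x) = enveloping D (ev D x) := by
  obtain ⟨a, x', rfl⟩ := Double.exists_of_add D x 1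
  have hX : ∀ y : Double D, compZero D (Phi D ((PowerSeries.X : ℂ⟦X⟧) ^ 1 • y)) = 0 := by
    intro y
    rw [pow_one, map_smul, Algebra.smul_def, map_mul]
    have : compZero D (algebraMap ℂ⟦X⟧ (CompletedYangian D) PowerSeries.X) = 0 :=
      CompletedYangian.scalar_X_mem 0 one_pos
    rw [this, zero_mul]
  have hX' : ∀ y : Double D, ev D ((PowerSeries.X : ℂ⟦X⟧) ^ 1 • y) = 0 := by
    intro y
    have := hbar_pow_smul_mem_evIdeal D 1 y
    rwa [Submodule.pow_one, mem_evIdeal] at this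
  rw [map_add, map_add, map_add, map_add, hX, hX', map_zero]
  congr 1
  refine Presented.ringHom_ext D
    (φ := (compZero D).comp ((Phi D).comp (Double.of D)).toRingHom)
    (ψ := (enveloping D).toRingHom.comp ((ev D).comp (Double.of D).toRingHom))
    (fun f => ?_) (fun y => ?_) a
  · have h1 := ((Phi D).comp (Double.of D)).commutes f
    have h2 : ev D (Double.of D (algebraMap ℂ⟦X⟧ _ f)) =
        algebraMap ℂ (KacMoody.U D) (PowerSeries.constantCoeff f) := by
      rw [AlgHom.commutes, ev_algebraMap]
    refine (congrArg (compZero D) h1).trans (Eq.trans ?_ (congrArg (enveloping D) h2).symm)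
    refine Eq.trans ?_ ((enveloping D).commutes _).symm
    refine (coeff_scalarSeries D 0 f).trans ?_
    rw [pow_zero, map_one, Algebra.algebraMap_eq_smul_one,
      PowerSeries.coeff_zero_eq_constantCoeff_apply]
  · refine (congrArg (compZero D) (Phi_gen D y)).trans
      (Eq.trans ?_ (congrArg (enveloping D) (ev_gen D y)).symm)
    have hC : ∀ (c : ℂ) (y : Yangian D), algebraMap ℂ ℂ[X] c • y = c • y := fun c y =>
      algebraMap_smul ℂ[X] c y
    cases y with
    | cart a =>
      rw [evGen, enveloping_gen]
      exact PowerSeries.coeff_monomial_same 0 _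
    | x e i r =>
      rw [evGen, map_smul, map_smul, enveloping_gen, chevalleyFamily, smul_smul,
        mul_inv_cancel₀ (sqrt_d_ne_zero D i), one_smul]
      refine (comp_binomialSeries _ (Yangian.x_mem D e i) r 0).trans ?_
      simp
    | h i r =>
      rw [evGen, enveloping_gen, chevalleyFamily]
      refine (comp_binomialSeries _ (Yangian.h_mem D i) r 0).trans ?_
      rw [Ring.choose_zero_right, one_smul]
      exact sub_eq_zero.1 (Presented.relator_eq_zero (.h_zero i))

theorem Phi_mem (n : ℕ) : ∀ x ∈ evIdeal D ^ n, Phi D x ∈ CompletedYangian.geq D n := by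
  refine CompletedYangian.map_pow_mem (evIdeal D) (Phi D).toRingHom (fun x hx k hk => ?_) n
  obtain rfl : k = 0 := by omega
  refine (compZero_Phi D x).trans ?_
  rw [(mem_evIdeal D).1 hx, map_zero]

end EvaluationFiltration

/-! ### Γ and the powers of the evaluation ideal -/

section GammaFiltration

/-- The coefficients of τ_{-1} are exactly those of the n-th difference at 0. -/
theorem iota_shift_sum (X : ℤ → Double D) (n : ℕ) :
    ∑ k ∈ Finset.range (n + 1), ((n.choose k : ℂ[X]) * (algebraMap ℂ ℂ[X] (-1)) ^ (n - k)) •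
      X k = (Δ_[1])^[n] X 0 := by
  rw [fwdDiff_iter_eq_sum_shift]
  refine Finset.sum_congr rfl fun k _ => ?_
  have : (n.choose k : ℂ[X]) * (algebraMap ℂ ℂ[X] (-1)) ^ (n - k) =
      (((-1) ^ (n - k) * n.choose k : ℤ) : ℂ[X]) := by
    rw [map_neg, map_one]; push_cast; ring
  rw [this, Int.cast_smul_eq_zsmul, zero_add, nsmul_one]

theorem Gamma_cart (a : H) : Gamma D (Yangian.gen D (.cart a)) = Double.gen D (.cart a) := by
  rw [Gamma, AlgHom.comp_apply, shift_gen]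
  exact iota_gen D (.cart a)

theorem Gamma_x (e : ℤˣ) (i : I) (n : ℕ) : Gamma D (Yangian.gen D (.x e i n)) =
    (Δ_[1])^[n] (fun s => Double.gen D (.x e i s)) 0 := by
  rw [Gamma, AlgHom.comp_apply, shift_gen, ← iota_shift_sum]
  simp only [shiftFamily, map_sum, map_smul, iota_gen, Gen.toInt]

theorem Gamma_h (i : I) (n : ℕ) : Gamma D (Yangian.gen D (.h i n)) =
    (Δ_[1])^[n] (fun s => Double.gen D (.h i s)) 0 := by
  rw [Gamma, AlgHom.comp_apply, shift_gen, ← iota_shift_sum]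
  simp only [shiftFamily, map_sum, map_smul, iota_gen, Gen.toInt]

theorem Gamma_algebraMap (p : ℂ[X]) :
    Gamma D (algebraMap ℂ[X] _ p) = algebraMap ℂ⟦X⟧ (Double D) (p : ℂ⟦X⟧) :=
  (Gamma D).commutes p

theorem Gamma_monomial_mem {k : ℕ} {y : Yangian D} (hy : Yangian.IsMonomial D k y) :
    Gamma D y ∈ evIdeal D ^ k := by
  have hmul : ∀ {m n : ℕ} {a b : Double D}, a ∈ evIdeal D ^ m → b ∈ evIdeal D ^ n →
      a * b ∈ evIdeal D ^ (m + n) := fun ha hb => by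
    rw [Ideal.IsTwoSided.pow_add]; exact Ideal.mul_mem_mul ha hb
  induction hy with
  | one => rw [Submodule.pow_zero, Ideal.one_eq_top]; trivial
  | hbar _ ih =>
    rw [map_mul, Gamma_algebraMap, Polynomial.coe_X]
    exact hmul ((Submodule.pow_one (evIdeal D)).symm ▸ hbar_mem_evIdeal D) ih
  | cart a _ ih => rw [map_mul]; exact Ideal.mul_mem_left _ _ ih
  | x e i r _ ih => rw [map_mul, Gamma_x]; exact hmul (fwdDiff_iter_x_mem D e i r 0) ih
  | h i r _ ih => rw [map_mul, Gamma_h]; exact hmul (fwdDiff_iter_h_mem D i r 0) ih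

theorem Gamma_mem {k : ℕ} {y : Yangian D} (hy : y ∈ Yangian.grade D k) :
    Gamma D y ∈ evIdeal D ^ k := by
  induction hy using Submodule.span_induction with
  | mem y hy => exact Gamma_monomial_mem D hy
  | zero => rw [map_zero]; exact zero_mem _
  | add a b _ _ ha hb => rw [map_add]; exact add_mem ha hb
  | smul c y _ hy =>
    rw [← algebraMap_smul ℂ[X] c y, map_smul, Algebra.smul_def]
    exact Ideal.mul_mem_left _ _ hy

end GammaFiltration

/-! ### Homogeneous components in the completion -/

section Homogeneous

/-- As `Yangian.grade` is a span of monomials, it suffices to multiply generators, whose images sit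
in single degrees. In particular the graded pieces are independent. -/
theorem CompletedYangian.incl_homogeneous {k : ℕ} {y : Yangian D} (hy : y ∈ Yangian.grade D k) :
    (incl D y).1 = PowerSeries.monomial k y := by
  have hm : ∀ a b : CompletedYangian D, (a * b).1 = a.1 * b.1 := fun _ _ => rfl
  have ha : ∀ a b : CompletedYangian D, (a + b).1 = a.1 + b.1 := fun _ _ => rfl
  have hsmul : ∀ (p : ℂ[X]) (n : ℕ) (a : Yangian D),
      p • (PowerSeries.monomial n a : (Yangian D)⟦X⟧) = PowerSeries.monomial n (p • a) := by
    intro p n a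
    ext k
    simp only [PowerSeries.coeff_smul, PowerSeries.coeff_monomial]
    split_ifs <;> simp
  induction hy using Submodule.span_induction with
  | mem y hy =>
    induction hy with
    | one =>
      rw [map_one]
      exact PowerSeries.monomial_zero_eq_C_apply (1 : Yangian D) ▸ (map_one _).symm
    | @hbar n y _ ih =>
      have := CompletedYangian.smul_C_mul_X_val D 1 (incl D y)
      rw [map_one, one_mul, ih] at this
      rw [← Algebra.smul_def, map_smul, this, PowerSeries.X_eq, PowerSeries.monomial_mul_monomial,
        one_mul, hsmul]
    | cart a _ ih =>
      rw [map_mul, hm, ih, incl_gen]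
      exact (PowerSeries.monomial_mul_monomial 0 _ _ _).trans (by rw [zero_add])
    | x e i r _ ih =>
      rw [map_mul, hm, ih, incl_gen]
      exact PowerSeries.monomial_mul_monomial r _ _ _
    | h i r _ ih =>
      rw [map_mul, hm, ih, incl_gen]
      exact PowerSeries.monomial_mul_monomial r _ _ _
  | zero => rw [map_zero, map_zero]; rfl
  | add a b _ _ iha ihb => rw [map_add, map_add, ha, iha, ihb]
  | smul c y _ hy =>
    rw [← algebraMap_smul ℂ[X] c y, map_smul, CompletedYangian.smul_C_val, hy, hsmul]

/-- Density of the Yangian in its completion, with explicit truncations as approximants. -/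
theorem CompletedYangian.sub_incl_mem (η : CompletedYangian D) (n : ℕ) :
    η - incl D (∑ k ∈ Finset.range n, comp D k η) ∈ geq D n := by
  intro k hk
  have h : ∀ l, comp D k (incl D (comp D l η)) = if k = l then comp D l η else 0 := fun l => by
    refine (congrArg (PowerSeries.coeff k) (incl_homogeneous D (η.2 l))).trans ?_
    exact PowerSeries.coeff_monomial _ _ _
  rw [map_sub, map_sum, map_sum]
  simp only [h]
  rw [Finset.sum_ite_eq, if_pos (Finset.mem_range.2 hk), sub_self]

end Homogeneous

/-! ### The induced maps and their mutual inversion -/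

section GammaHat

/-- The triangle i + j < n may be enlarged to the square. This makes the truncated Γ multiplicative,
because products of total degree at least n land in 𝒥^n. -/
theorem sum_range_antidiagonal {M : Type*} [AddCommMonoid M] (n : ℕ) (f : ℕ × ℕ → M)
    (hf : ∀ p, n ≤ p.1 + p.2 → f p = 0) :
    ∑ k ∈ Finset.range n, ∑ p ∈ Finset.HasAntidiagonal.antidiagonal k, f p =
      ∑ i ∈ Finset.range n, ∑ j ∈ Finset.range n, f (i, j) := by
  rw [← Finset.sum_product', ← Finset.sum_filter_of_ne (p := fun p => p.1 + p.2 < n)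
      fun p _ hp => not_le.1 fun h => hp (hf p h),
    ← Finset.sum_fiberwise_of_maps_to (g := fun p : ℕ × ℕ => p.1 + p.2) (t := Finset.range n)
      (fun p hp => Finset.mem_range.2 (Finset.mem_filter.1 hp).2) f]
  refine Finset.sum_congr rfl fun k hk => Finset.sum_congr ?_ fun _ _ => rfl
  have := Finset.mem_range.1 hk
  ext p
  simp only [Finset.HasAntidiagonal.mem_antidiagonal, Finset.mem_filter, Finset.mem_product,
    Finset.mem_range]
  omega

/-- The class of `∑_{k < n} Γ (η_k)` in `DY / 𝒥 ^ n`. -/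
noncomputable def gammaTruncAdd (n : ℕ) : CompletedYangian D →+ Double D ⧸ evIdeal D ^ n :=
  ∑ k ∈ Finset.range n, ((Ideal.Quotient.mk (evIdeal D ^ n)).toAddMonoidHom.comp
    (Gamma D).toRingHom.toAddMonoidHom).comp (CompletedYangian.comp D k)

theorem gammaTruncAdd_apply (n : ℕ) (η : CompletedYangian D) : gammaTruncAdd D n η =
    ∑ k ∈ Finset.range n, Ideal.Quotient.mk (evIdeal D ^ n)
      (Gamma D (CompletedYangian.comp D k η)) := by
  simp [gammaTruncAdd]

theorem gammaTruncAdd_mul (n : ℕ) (η ζ : CompletedYangian D) :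
    gammaTruncAdd D n (η * ζ) = gammaTruncAdd D n η * gammaTruncAdd D n ζ := by
  simp only [gammaTruncAdd_apply, CompletedYangian.comp_mul, map_sum, map_mul,
    Finset.sum_mul_sum]
  refine sum_range_antidiagonal n (fun p =>
    Ideal.Quotient.mk (evIdeal D ^ n) (Gamma D (CompletedYangian.comp D p.1 η)) *
      Ideal.Quotient.mk (evIdeal D ^ n) (Gamma D (CompletedYangian.comp D p.2 ζ))) fun p hp => ?_
  rw [← map_mul, ← map_mul, Ideal.Quotient.eq_zero_iff_mem]
  exact Ideal.pow_le_pow_right hp (Gamma_mem D (Yangian.mul_mem_grade D (η.2 _) (ζ.2 _)))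

theorem gammaTruncAdd_algebraMap (n : ℕ) (f : ℂ⟦X⟧) :
    gammaTruncAdd D n (algebraMap ℂ⟦X⟧ _ f) =
      Ideal.Quotient.mk (evIdeal D ^ n) (algebraMap ℂ⟦X⟧ _ f) := by
  have h : ∀ k, CompletedYangian.comp D k (algebraMap ℂ⟦X⟧ _ f) =
      algebraMap ℂ[X] (Yangian D) (Polynomial.monomial k (PowerSeries.coeff k f)) := by
    intro k
    refine (coeff_scalarSeries D k f).trans ?_
    rw [← Polynomial.smul_X_eq_monomial, Algebra.algebraMap_eq_smul_one,
      Algebra.algebraMap_eq_smul_one, smul_assoc]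
  rw [gammaTruncAdd_apply]
  simp only [h, Gamma_algebraMap, ← map_sum]
  have ht : ∑ k ∈ Finset.range n, ((Polynomial.monomial k (PowerSeries.coeff k f) : ℂ[X]) : ℂ⟦X⟧) =
      ((PowerSeries.trunc n f : ℂ[X]) : ℂ⟦X⟧) := by
    ext m
    simp only [map_sum, Polynomial.coeff_coe, Polynomial.coeff_monomial, PowerSeries.coeff_trunc,
      Finset.sum_ite_eq', Finset.mem_range]
  -- Truncating the scalar at order n changes it by a multiple of ħ^n, which is zero modulo 𝒥^n.
  obtain ⟨g, hg⟩ : (PowerSeries.X : ℂ⟦X⟧) ^ n ∣ ((PowerSeries.trunc n f : ℂ[X]) : ℂ⟦X⟧) - f :=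
    PowerSeries.X_pow_dvd_iff.2 fun m hm => by
      rw [map_sub, Polynomial.coeff_coe, PowerSeries.coeff_trunc, if_pos hm, sub_self]
  rw [ht, Ideal.Quotient.eq, ← map_sub, hg, map_mul, ← map_mul, ← smul_eq_mul,
    Algebra.algebraMap_eq_smul_one, smul_assoc]
  exact hbar_pow_smul_mem_evIdeal D n _

/-- The homomorphism `∏_k Y_k → DY / 𝒥 ^ n` induced by `Γ`. -/
noncomputable def gammaTrunc (n : ℕ) : CompletedYangian D →ₐ[ℂ⟦X⟧] Double D ⧸ evIdeal D ^ n :=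
  { gammaTruncAdd D n with
    map_one' := by simpa using gammaTruncAdd_algebraMap D n 1
    map_mul' := gammaTruncAdd_mul D n
    commutes' := gammaTruncAdd_algebraMap D n }

theorem gammaTrunc_apply (n : ℕ) (η : CompletedYangian D) : gammaTrunc D n η =
    ∑ k ∈ Finset.range n, Ideal.Quotient.mk (evIdeal D ^ n)
      (Gamma D (CompletedYangian.comp D k η)) :=
  gammaTruncAdd_apply D n η

theorem gammaTrunc_eq_of_sub_mem {n : ℕ} {η ζ : CompletedYangian D}
    (h : η - ζ ∈ CompletedYangian.geq D n) : gammaTrunc D n η = gammaTrunc D n ζ := by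
  rw [← sub_eq_zero, ← map_sub, gammaTrunc_apply]
  refine Finset.sum_eq_zero fun k hk => ?_
  rw [h k (Finset.mem_range.1 hk), map_zero, map_zero]

theorem gammaTrunc_single (n k : ℕ) {y : Yangian D} (hy : y ∈ Yangian.grade D k) :
    gammaTrunc D n (CompletedYangian.single D k y hy) =
      Ideal.Quotient.mk (evIdeal D ^ n) (Gamma D y) := by
  have h : ∀ l, CompletedYangian.comp D l (CompletedYangian.single D k y hy) =
      if l = k then y else 0 := fun l => PowerSeries.coeff_monomial _ _ _
  rw [gammaTrunc_apply]
  simp only [h, apply_ite (Gamma D), apply_ite (Ideal.Quotient.mk (evIdeal D ^ n)), map_zero,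
    Finset.sum_ite_eq', Finset.mem_range]
  split_ifs with hk
  · rfl
  · exact (Ideal.Quotient.eq_zero_iff_mem.2
      (Ideal.pow_le_pow_right (not_lt.1 hk) (Gamma_mem D hy))).symm

theorem gammaTrunc_incl (n : ℕ) (y : Yangian D) :
    gammaTrunc D n (CompletedYangian.incl D y) =
      Ideal.Quotient.mk (evIdeal D ^ n) (Gamma D y) := by
  refine Presented.ringHom_ext D
    (φ := (gammaTrunc D n).toRingHom.comp (CompletedYangian.incl D).toRingHom)
    (ψ := (Ideal.Quotient.mk (evIdeal D ^ n)).comp (Gamma D).toRingHom)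
    (fun p => ?_) (fun y => ?_) y
  · exact (congrArg (gammaTrunc D n) ((CompletedYangian.incl D).commutes p)).trans
      (((gammaTrunc D n).commutes (p : ℂ⟦X⟧)).trans
        (congrArg (Ideal.Quotient.mk (evIdeal D ^ n)) (Gamma_algebraMap D p)).symm)
  · refine (congrArg (gammaTrunc D n) (CompletedYangian.incl_gen D y)).trans ?_
    cases y with
    | cart a => exact gammaTrunc_single D n 0 (Yangian.cart_mem D a)
    | x e i r => exact gammaTrunc_single D n r (Yangian.x_mem D e i r)
    | h i r => exact gammaTrunc_single D n r (Yangian.h_mem D i r)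

/-- The left side is ∑_{k<n} (r choose k) Γ(c_k), which is Newton's expansion of `X` modulo 𝒥^n. -/
theorem gammaTrunc_binomialSeries (n : ℕ) (c : ℕ → Yangian D)
    (hc : ∀ n, c n ∈ Yangian.grade D n) (X : ℤ → Double D)
    (h : ∀ k, Gamma D (c k) = (Δ_[1])^[k] X 0) (hX : ∀ r, (Δ_[1])^[n] X r ∈ evIdeal D ^ n) (r : ℤ) :
    gammaTrunc D n (binomialSeries c hc r) = Ideal.Quotient.mk (evIdeal D ^ n) (X r) := by
  have hmap := fun k r => fwdDiff_iter_map (Ideal.Quotient.mk (evIdeal D ^ n)).toAddMonoidHom k X r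
  refine Eq.trans ?_ (newton_expansion n
    (f := fun r => (Ideal.Quotient.mk (evIdeal D ^ n)).toAddMonoidHom (X r)) ?_ r).symm
  · rw [gammaTrunc_apply]
    refine Finset.sum_congr rfl fun k _ => ?_
    rw [comp_binomialSeries, map_zsmul, map_zsmul, h, hmap]
    rfl
  · funext r
    rw [hmap]
    exact Ideal.Quotient.eq_zero_iff_mem.2 (hX r)

/-- Multiples of ħ^n vanish on both sides, which leaves the presented algebra; on its generators
this is Newton's formula. -/
theorem gammaTrunc_Phi (n : ℕ) (x : Double D) :
    gammaTrunc D n (Phi D x) = Ideal.Quotient.mk (evIdeal D ^ n) x := by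
  obtain ⟨a, x', rfl⟩ := Double.exists_of_add D x n
  have hm := hbar_pow_smul_mem_evIdeal D n x'
  rw [map_add, map_add, map_add, Ideal.Quotient.eq_zero_iff_mem.2 hm,
    gammaTrunc_eq_of_sub_mem D (η := Phi D (PowerSeries.X ^ n • x')) (ζ := 0)
      (by rw [sub_zero]; exact Phi_mem D n _ hm), map_zero]
  congr 1
  refine Presented.ringHom_ext D
    (φ := ((gammaTrunc D n).comp ((Phi D).comp (Double.of D))).toRingHom)
    (ψ := (Ideal.Quotient.mk (evIdeal D ^ n)).comp (Double.of D).toRingHom)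
    (fun f => ?_) (fun y => ?_) a
  · exact (((gammaTrunc D n).comp ((Phi D).comp (Double.of D))).commutes f).trans
      (congrArg (Ideal.Quotient.mk (evIdeal D ^ n)) ((Double.of D).commutes f)).symm
  · refine (congrArg (gammaTrunc D n) (Phi_gen D y)).trans ?_
    cases y with
    | cart a =>
      refine (gammaTrunc_single D n 0 (Yangian.cart_mem D a)).trans ?_
      rw [Gamma_cart]; rfl
    | x e i r =>
      exact gammaTrunc_binomialSeries D n _ (Yangian.x_mem D e i) _ (Gamma_x D e i)
        (fwdDiff_iter_x_mem D e i n) r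
    | h i r =>
      exact gammaTrunc_binomialSeries D n _ (Yangian.h_mem D i) _ (Gamma_h D i)
        (fwdDiff_iter_h_mem D i n) r

/-- `Phi` commutes with differences, and the n-th difference at 0 of the Newton series of x_{i,n} or
h_{i,n} is its n-th coefficient. -/
theorem Phi_Gamma (y : Yangian D) : Phi D (Gamma D y) = CompletedYangian.incl D y := by
  refine Presented.ringHom_ext D (φ := (Phi D).toRingHom.comp (Gamma D).toRingHom)
    (ψ := (CompletedYangian.incl D).toRingHom) (fun p => ?_) (fun y => ?_) y
  · exact (congrArg (Phi D) (Gamma_algebraMap D p)).trans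
      (((Phi D).commutes _).trans ((CompletedYangian.incl D).commutes p).symm)
  · refine Eq.trans ?_ (CompletedYangian.incl_gen D y).symm
    cases y with
    | cart a => exact (congrArg (Phi D) (Gamma_cart D a)).trans (Phi_gen D (.cart a))
    | x e i r =>
      refine (congrArg (Phi D) (Gamma_x D e i r)).trans
        ((fwdDiff_iter_map (Phi D).toRingHom.toAddMonoidHom r _ 0).symm.trans ?_)
      refine Eq.trans ?_ (fwdDiff_binomialSeries_zero _ (Yangian.x_mem D e i) r)
      exact congrArg (fun f => (Δ_[1])^[r] f 0) (funext fun s => Phi_gen D (.x e i s))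
    | h i r =>
      refine (congrArg (Phi D) (Gamma_h D i r)).trans
        ((fwdDiff_iter_map (Phi D).toRingHom.toAddMonoidHom r _ 0).symm.trans ?_)
      refine Eq.trans ?_ (fwdDiff_binomialSeries_zero _ (Yangian.h_mem D i) r)
      exact congrArg (fun f => (Δ_[1])^[r] f 0) (funext fun s => Phi_gen D (.h i s))

/-- The homomorphism `Γhat` from the completed Yangian to the completion of the Yangian double. -/
noncomputable def GammaHat : CompletedYangian D →ₐ[ℂ⟦X⟧] EvalCompletion D :=
  (AlgHom.pi fun n => gammaTrunc D n).codRestrict _ fun η m n hmn => by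
    change Ideal.Quotient.factorₐ ℂ⟦X⟧ _ (gammaTrunc D n η) = gammaTrunc D m η
    rw [gammaTrunc_apply, ← map_sum, ← map_sum]
    -- Both sides are computed from the same truncation of `η` below degree `n`, which also
    -- approximates it modulo degree ≥ m since m ≤ n.
    refine Eq.trans ?_ (gammaTrunc_eq_of_sub_mem D fun k hk =>
      CompletedYangian.sub_incl_mem D η n k (lt_of_lt_of_le hk hmn)).symm
    rw [gammaTrunc_incl]
    rfl

theorem proj_GammaHat (n : ℕ) (η : CompletedYangian D) :
    adicCompletion.proj ℂ⟦X⟧ (evIdeal D) n (GammaHat D η) = gammaTrunc D n η := rfl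

theorem inducesGamma_GammaHat : InducesGamma D (Gamma D) (GammaHat D) := fun n η y h => by
  rw [proj_GammaHat, gammaTrunc_eq_of_sub_mem D h, gammaTrunc_incl]

/-- The homomorphism `Φhat` from the completion of the Yangian double to the completed Yangian. -/
noncomputable def PhiHat : EvalCompletion D →ₐ[ℂ⟦X⟧] CompletedYangian D :=
  completionLift (evIdeal D) (Phi D) (Phi_mem D)

theorem inducesPhi_PhiHat : InducesPhi D (Phi D) (PhiHat D) :=
  completionLift_sub_mem (evIdeal D) (Phi D) (Phi_mem D)

theorem PhiHat_comp_GammaHat :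
    (PhiHat D).comp (GammaHat D) = AlgHom.id ℂ⟦X⟧ (CompletedYangian D) := by
  ext η
  refine CompletedYangian.eq_of_sub_mem_geq fun n => ?_
  have h := CompletedYangian.sub_incl_mem D η n
  -- With y the truncation of `η` below degree n, the image of `η` is congruent to Φ(Γ y), the image
  -- of y in the completion, and hence to `η` itself.
  have h' := inducesPhi_PhiHat D n _ _ (inducesGamma_GammaHat D n η _ h)
  rw [Phi_Gamma] at h'
  have := Ideal.sub_mem _ h' h
  rwa [sub_sub_sub_cancel_right] at this

theorem GammaHat_comp_PhiHat :
    (GammaHat D).comp (PhiHat D) = AlgHom.id ℂ⟦X⟧ (EvalCompletion D) := by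
  refine AlgHom.ext fun ξ => Subtype.ext (funext fun n => ?_)
  obtain ⟨x, hx⟩ := Ideal.Quotient.mk_surjective (adicCompletion.proj ℂ⟦X⟧ (evIdeal D) n ξ)
  change gammaTrunc D n (PhiHat D ξ) = adicCompletion.proj ℂ⟦X⟧ (evIdeal D) n ξ
  rw [gammaTrunc_eq_of_sub_mem D (inducesPhi_PhiHat D n ξ x hx.symm), gammaTrunc_Phi, hx]

end GammaHat

end YangianDouble

theorem theorem5p4 {I H : Type*} [Fintype I] [DecidableEq I] [AddCommGroup H] [Module ℂ H]
    (D : CartanRealization I H) :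
    ∃ Φ : Double D →ₐ[ℂ⟦X⟧] CompletedYangian D,
      (∀ y : Yangian D, Φ (iota D y) = CompletedYangian.incl D (shift D 1 y)) ∧
      (∀ Φ' : Double D →ₐ[ℂ⟦X⟧] CompletedYangian D,
        (∀ y : Yangian D, Φ' (iota D y) = CompletedYangian.incl D (shift D 1 y)) → Φ' = Φ) ∧
      (∀ (e : ℤˣ) (i : I) (r : ℤ) (n : ℕ), CompletedYangian.comp D n (Φ (Double.gen D (.x e i r))) =
        Ring.choose r n • Yangian.gen D (.x e i n)) ∧
      (∀ (i : I) (r : ℤ) (n : ℕ), CompletedYangian.comp D n (Φ (Double.gen D (.h i r))) =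
        Ring.choose r n • Yangian.gen D (.h i n)) ∧
      ∃ (Φhat : EvalCompletion D →ₐ[ℂ⟦X⟧] CompletedYangian D)
        (Γhat : CompletedYangian D →ₐ[ℂ⟦X⟧] EvalCompletion D),
        InducesPhi D Φ Φhat ∧ InducesGamma D (Gamma D) Γhat ∧
        Φhat.comp Γhat = AlgHom.id ℂ⟦X⟧ (CompletedYangian D) ∧
        Γhat.comp Φhat = AlgHom.id ℂ⟦X⟧ (EvalCompletion D) := by
  exact ⟨Phi D, Phi_iota D, fun _ h => eq_Phi D h,
    fun e i r n => (congrArg (CompletedYangian.comp D n) (Phi_gen D _)).trans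
      (comp_binomialSeries _ (Yangian.x_mem D e i) r n),
    fun i r n => (congrArg (CompletedYangian.comp D n) (Phi_gen D _)).trans
      (comp_binomialSeries _ (Yangian.h_mem D i) r n),
    PhiHat D, GammaHat D, inducesPhi_PhiHat D, inducesGamma_GammaHat D,
    PhiHat_comp_GammaHat D, GammaHat_comp_PhiHat D⟩
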